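/- For a finite field $\mathbb F_q$, a set $A\subseteq\mathbb F_q$ and $\xi\in\mathbb F_q^*$, let $E(A,\xi A)$ be the number of quadruples $(a_1,a_2,a_3,a_4)\in A^4$ with $a_1-a_2=\xi(a_3-a_4)$. There exist absolute constants $C_0,C>0$ and integers $k_0,k\ge 0$ such that the following holds for every prime power $q$. Let $A,X\subseteq\mathbb F_q^*$ and let $K>0$ be a real number such that \[ C_0(\log q)^{k_0}K^{1504}\le |X|,\qquad C_0(\log q)^{k_0}\,q^{1/4}K^4\le |X|<q^{1/2},\qquad C_0(\log q)^{k_0}\,q^{1/2}K^{85}\le |A|\le q^{2/3}, \] and $E(A,\xi A)\ge |A|^3/K$ for all $\xi\in X$. Then there are a subfield $F\subseteq\mathbb F_q$ of cardinality $q^{1/3}$ (in particular $q$ is a cube), an element $\bar a\in A$, and a two-dimensional $F$-vector subspace $V\subseteq\mathbb F_q$ such that \[ K^{-85}|A|\le C(\log q)^{k}\,\bigl|(A-\bar a)\cap V\bigr|. \] -/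

import Mathlib

/-- The energy `E(A, ξA)`: the number of ordered quadruples `(a₁, a₂, a₃, a₄) ∈ A⁴` with
`a₁ - a₂ = ξ (a₃ - a₄)`. -/
def dilateEnergy {𝔽 : Type*} [Field 𝔽] [DecidableEq 𝔽] (A : Finset 𝔽) (ξ : 𝔽) : ℕ :=
  ((A ×ˢ A ×ˢ A ×ˢ A).filter
    (fun t => t.1 - t.2.1 = ξ * (t.2.2.1 - t.2.2.2))).card

open scoped Pointwise

/-! Put κ = 96 K log q. By Balog–Szemerédi–Gowers, each energy hypothesis yields dense A', B' ⊆ A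
with |A' - ξB'| ≤ κ³|A| (`exists_subsets_card_sub_smul_le`). A second-moment pigeonhole over ξ and
Ruzsa calculus condense these into a single B = ξ₀B₀, B₀ ⊆ A, which has small doubling and few
differences with ηB for every η in a large set Y of ratios ξ/ξ₀ (`exists_set_card_smul_sub_le`).

Thus H = B - B is an approximate group almost stable under Y. Let R be the set of quotients of
differences of Y. If R is stable under ρ ↦ ρ + 1 and under multiplication by Y, it contains a
subfield F ⊇ Y. Otherwise some e/f of low complexity lies outside R, so (y, y') ↦ fy + ey' is
injective on Y². Since |Y|⁴ > q, pigeonholing then writes every ζ as a quotient of low complexity,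
and H has large energy with all its dilates. This contradicts the average energy over dilates. So F
exists, and H has large energy with ζH for all ζ ∈ F (`exists_subfield_dilateEnergy_ge`).

Fourier analysis of the energies over F forces a large part of H into a coset of an F-hyperplane V
(`exists_hyperplane_large_inter`). Hence B meets few cosets of V, and averaging the energies of B
over Y ⊆ F gives one coset containing a proportion κ⁻²⁰ of B. Finally |F| ≥ |Y| > q^{1/4} gives [𝔽 :
F] ≤ 3, while |V| > q^{1/2} excludes degree at most 2. The degree is therefore 3 and V is a plane.
-/

/-! ### Balog–Szemerédi–Gowers for the energy with a dilate -/

set_option maxHeartbeats 1000000 in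
/-- Balog–Szemerédi–Gowers graph lemma: a dense bipartite graph contains large vertex sets any two
elements of which are joined by many paths of length three. -/
theorem exists_subsets_many_paths_three {α β : Type*} [DecidableEq α] [DecidableEq β]
    {A : Finset α} {B : Finset β} {G : Finset (α × β)} (hA : A.Nonempty) (hB : B.Nonempty)
    (hG : G ⊆ A ×ˢ B) {δ : ℝ} (hδ : 0 < δ) (hcard : δ * A.card * B.card ≤ G.card) :
    ∃ A' ⊆ A, ∃ B' ⊆ B, δ * A.card / 6 ≤ A'.card ∧ δ * B.card / 4 ≤ B'.card ∧
      ∀ a ∈ A', ∀ b ∈ B', δ ^ 5 * A.card * B.card / 3072 ≤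
        (((A ×ˢ B).filter fun p => (a, p.2) ∈ G ∧ p ∈ G ∧ (p.1, b) ∈ G).card : ℝ) := by
  classical
  have hn : (0 : ℝ) < A.card := by exact_mod_cast hA.card_pos
  have hm : (0 : ℝ) < B.card := by exact_mod_cast hB.card_pos
  set n : ℝ := (A.card : ℝ) with hn_def
  set m : ℝ := (B.card : ℝ) with hm_def
  set deg : α → ℝ := fun a => ((B.filter fun b => (a, b) ∈ G).card : ℝ) with hdeg
  have hdegsum : ∀ S ⊆ A, ∑ b ∈ B, ((S.filter fun a => (a, b) ∈ G).card : ℝ) = ∑ a ∈ S, deg a := by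
    intro S _
    simp only [hdeg, Finset.card_filter, Nat.cast_sum]
    exact Finset.sum_comm
  have hGsum : (G.card : ℝ) = ∑ a ∈ A, deg a := by
    have : G = (A ×ˢ B).filter (· ∈ G) := by
      ext p; simp only [Finset.mem_filter]; exact ⟨fun h => ⟨hG h, h⟩, fun h => h.2⟩
    rw [this, Finset.card_filter, Finset.sum_product]
    simp only [hdeg, Finset.card_filter, Nat.cast_sum]
  -- Vertices of degree below δm/2 carry at most half of the edges, so they can be discarded.
  set Ah := A.filter fun a => δ * m / 2 ≤ deg a with hAh
  have hAhA : Ah ⊆ A := Finset.filter_subset _ _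
  have hAhsum : δ * n * m / 2 ≤ ∑ a ∈ Ah, deg a := by
    have h1 : ∑ a ∈ A.filter (fun a => ¬ δ * m / 2 ≤ deg a), deg a ≤ n * (δ * m / 2) := by
      calc _ ≤ ∑ a ∈ A.filter (fun a => ¬ δ * m / 2 ≤ deg a), (δ * m / 2) :=
            Finset.sum_le_sum fun a ha => (not_le.1 (Finset.mem_filter.1 ha).2).le
        _ = ((A.filter (fun a => ¬ δ * m / 2 ≤ deg a)).card : ℝ) * (δ * m / 2) := by
            rw [Finset.sum_const, nsmul_eq_mul]
        _ ≤ n * (δ * m / 2) := by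
            gcongr; rw [hn_def]; exact_mod_cast Finset.card_filter_le _ _
    have h2 := Finset.sum_filter_add_sum_filter_not A (fun a => δ * m / 2 ≤ deg a) deg
    rw [← hGsum] at h2
    linarith
  set N : β → Finset α := fun b => Ah.filter fun a => (a, b) ∈ G with hN
  set codeg : α → α → ℝ := fun a a' =>
    ((B.filter fun b => (a, b) ∈ G ∧ (a', b) ∈ G).card : ℝ) with hcodeg
  set bad : β → Finset (α × α) := fun b =>
    (N b ×ˢ N b).filter fun p => codeg p.1 p.2 < δ ^ 3 * m / 128 with hbad
  -- A bad pair is counted once for each of its common neighbours, and by definition it has few.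
  have hbadsum : ∑ b ∈ B, ((bad b).card : ℝ) ≤ n ^ 2 * (δ ^ 3 * m / 128) := by
    have h1 : ∀ b, bad b = ((Ah ×ˢ Ah).filter fun p => codeg p.1 p.2 < δ ^ 3 * m / 128).filter
        fun p => (p.1, b) ∈ G ∧ (p.2, b) ∈ G := by
      intro b; ext p
      simp only [hbad, hN, Finset.mem_filter, Finset.mem_product]; tauto
    have h2 : ∑ b ∈ B, ((bad b).card : ℝ) =
        ∑ p ∈ (Ah ×ˢ Ah).filter (fun p => codeg p.1 p.2 < δ ^ 3 * m / 128), codeg p.1 p.2 := by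
      simp only [h1, hcodeg]
      simp only [Finset.card_filter _ B, Nat.cast_sum]
      rw [Finset.sum_comm]
      refine Finset.sum_congr rfl fun b _ => ?_
      rw [Finset.card_filter, Nat.cast_sum]
    rw [h2]
    calc _ ≤ ∑ p ∈ (Ah ×ˢ Ah).filter (fun p => codeg p.1 p.2 < δ ^ 3 * m / 128), δ ^ 3 * m / 128 :=
          Finset.sum_le_sum fun p hp => (Finset.mem_filter.1 hp).2.le
      _ = (((Ah ×ˢ Ah).filter (fun p => codeg p.1 p.2 < δ ^ 3 * m / 128)).card : ℝ) *
          (δ ^ 3 * m / 128) := by rw [Finset.sum_const, nsmul_eq_mul]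
      _ ≤ n ^ 2 * (δ ^ 3 * m / 128) := by
          gcongr
          have : ((Ah ×ˢ Ah).filter (fun p => codeg p.1 p.2 < δ ^ 3 * m / 128)).card ≤
              A.card ^ 2 := by
            refine (Finset.card_filter_le _ _).trans ?_
            rw [Finset.card_product, sq]
            exact Nat.mul_le_mul (Finset.card_le_card hAhA) (Finset.card_le_card hAhA)
          rw [hn_def]; exact_mod_cast this
  have hNsq : δ ^ 2 * n ^ 2 * m / 4 ≤ ∑ b ∈ B, ((N b).card : ℝ) ^ 2 := by
    have h1 := sq_sum_le_card_mul_sum_sq (s := B) (f := fun b => ((N b).card : ℝ))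
    rw [hdegsum Ah hAhA] at h1
    have h2 : (δ * n * m / 2) ^ 2 ≤ m * ∑ b ∈ B, ((N b).card : ℝ) ^ 2 :=
      (pow_le_pow_left₀ (by positivity) hAhsum 2).trans h1
    refine le_of_mul_le_mul_left (a := m) ?_ hm
    linarith [h2, show (δ * n * m / 2) ^ 2 = m * (δ ^ 2 * n ^ 2 * m / 4) by ring]
  -- The weight 16/δ makes the bad pairs cost exactly half of the second moment in `hNsq`. One
  -- vertex b₀ then has both a large neighbourhood and a proportion at most δ/16 of bad pairs in it.
  obtain ⟨b₀, hb₀, hb₀le⟩ : ∃ b ∈ B, δ ^ 2 * n ^ 2 / 8 ≤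
      ((N b).card : ℝ) ^ 2 - 16 / δ * ((bad b).card : ℝ) := by
    refine Finset.exists_le_of_sum_le hB ?_
    rw [Finset.sum_const, nsmul_eq_mul, Finset.sum_sub_distrib, ← Finset.mul_sum]
    have h3 : 16 / δ * ∑ b ∈ B, ((bad b).card : ℝ) ≤ 16 / δ * (n ^ 2 * (δ ^ 3 * m / 128)) := by
      gcongr
    have h4 : 16 / δ * (n ^ 2 * (δ ^ 3 * m / 128)) = δ ^ 2 * n ^ 2 * m / 8 := by
      field_simp; ring
    rw [← hm_def]
    linarith
  set A₁ := N b₀ with hA₁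
  have hA₁A : A₁ ⊆ A := (Finset.filter_subset _ _).trans hAhA
  set l : ℝ := (A₁.card : ℝ) with hl_def
  have hbad0 : (0 : ℝ) ≤ 16 / δ * ((bad b₀).card : ℝ) := by positivity
  have hl : δ * n / 3 ≤ l := by
    refine le_of_sq_le_sq ?_ (by positivity)
    nlinarith [sq_nonneg (δ * n)]
  have hlpos : 0 < l := lt_of_lt_of_le (by positivity) hl
  have hbadle : ((bad b₀).card : ℝ) ≤ δ * l ^ 2 / 16 := by
    have h1 : 16 / δ * ((bad b₀).card : ℝ) ≤ l ^ 2 := by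
      have : 0 ≤ δ ^ 2 * n ^ 2 / 8 := by positivity
      linarith
    rw [div_mul_eq_mul_div, div_le_iff₀ hδ] at h1
    linarith
  set badv : α → ℝ := fun a => ((A₁.filter fun a' => codeg a a' < δ ^ 3 * m / 128).card : ℝ)
    with hbadv
  have hbadvsum : ∑ a ∈ A₁, badv a = ((bad b₀).card : ℝ) := by
    simp only [hbad, hbadv, Finset.card_filter, Nat.cast_sum]
    rw [Finset.sum_product]
  refine ⟨A₁.filter fun a => badv a ≤ δ * l / 8, (Finset.filter_subset _ _).trans hA₁A,
    B.filter fun b => δ * l / 4 ≤ ((A₁.filter fun a => (a, b) ∈ G).card : ℝ),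
    Finset.filter_subset _ _, ?_, ?_, ?_⟩
  · have h1 : ((A₁.filter fun a => ¬ badv a ≤ δ * l / 8).card : ℝ) * (δ * l / 8) ≤
        δ * l ^ 2 / 16 := by
      rw [← nsmul_eq_mul, ← Finset.sum_const]
      refine le_trans ?_ (hbadvsum.le.trans hbadle)
      refine (Finset.sum_le_sum fun a ha => (not_le.1 (Finset.mem_filter.1 ha).2).le).trans ?_
      exact Finset.sum_le_sum_of_subset_of_nonneg (Finset.filter_subset _ _)
        fun a _ _ => by positivity
    have h2 : ((A₁.filter fun a => badv a ≤ δ * l / 8).card : ℝ) +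
        ((A₁.filter fun a => ¬ badv a ≤ δ * l / 8).card : ℝ) = l := by
      rw [hl_def]
      exact_mod_cast Finset.card_filter_add_card_filter_not (s := A₁) (fun a => badv a ≤ δ * l / 8)
    have h3 : ((A₁.filter fun a => ¬ badv a ≤ δ * l / 8).card : ℝ) ≤ l / 2 := by
      refine le_of_mul_le_mul_right (a := δ * l / 8) ?_ (by positivity)
      linarith [show l / 2 * (δ * l / 8) = δ * l ^ 2 / 16 by ring]
    linarith
  · have h1 : l * (δ * m / 2) ≤ ∑ b ∈ B, ((A₁.filter fun a => (a, b) ∈ G).card : ℝ) := by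
      rw [hdegsum A₁ hA₁A, hl_def, ← nsmul_eq_mul, ← Finset.sum_const]
      exact Finset.sum_le_sum fun a ha =>
        (Finset.mem_filter.1 ((Finset.filter_subset _ _ : A₁ ⊆ Ah) ha)).2
    have h2 := Finset.sum_filter_add_sum_filter_not B
      (fun b => δ * l / 4 ≤ ((A₁.filter fun a => (a, b) ∈ G).card : ℝ))
      (fun b => ((A₁.filter fun a => (a, b) ∈ G).card : ℝ))
    have h3 : ∑ b ∈ B.filter (fun b => ¬ δ * l / 4 ≤ ((A₁.filter fun a => (a, b) ∈ G).card : ℝ)),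
        ((A₁.filter fun a => (a, b) ∈ G).card : ℝ) ≤ m * (δ * l / 4) := by
      refine (Finset.sum_le_sum fun b hb => (not_le.1 (Finset.mem_filter.1 hb).2).le).trans ?_
      rw [Finset.sum_const, nsmul_eq_mul]
      gcongr; rw [hm_def]; exact_mod_cast Finset.card_filter_le _ _
    have h4 : ∑ b ∈ B.filter (fun b => δ * l / 4 ≤ ((A₁.filter fun a => (a, b) ∈ G).card : ℝ)),
        ((A₁.filter fun a => (a, b) ∈ G).card : ℝ) ≤
        ((B.filter fun b => δ * l / 4 ≤ ((A₁.filter fun a => (a, b) ∈ G).card : ℝ)).card : ℝ) *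
          l := by
      rw [← nsmul_eq_mul, ← Finset.sum_const]
      refine Finset.sum_le_sum fun b _ => ?_
      rw [hl_def]; exact_mod_cast Finset.card_filter_le _ _
    refine le_of_mul_le_mul_right (a := l) ?_ hlpos
    linarith
  · intro a ha b hb
    obtain ⟨ha1, hab⟩ := Finset.mem_filter.1 ha
    obtain ⟨hb1, hbd⟩ := Finset.mem_filter.1 hb
    -- Middle vertices a' of the paths a, b', a', b: of the at least δl/4 neighbours of b in A₁, at
    -- most δl/8 form a bad pair with a.
    set S := (A₁.filter fun a' => (a', b) ∈ G).filter fun a' => ¬ codeg a a' < δ ^ 3 * m / 128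
      with hS
    have hScard : δ * l / 8 ≤ (S.card : ℝ) := by
      have h1 : (((A₁.filter fun a' => (a', b) ∈ G).filter
          fun a' => codeg a a' < δ ^ 3 * m / 128).card : ℝ) + (S.card : ℝ) =
          ((A₁.filter fun a' => (a', b) ∈ G).card : ℝ) := by
        exact_mod_cast Finset.card_filter_add_card_filter_not
          (s := A₁.filter fun a' => (a', b) ∈ G) (fun a' => codeg a a' < δ ^ (3 : ℕ) * m / 128)
      have h2 : (((A₁.filter fun a' => (a', b) ∈ G).filter
          fun a' => codeg a a' < δ ^ 3 * m / 128).card : ℝ) ≤ badv a := by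
        simp only [hbadv]
        exact_mod_cast Finset.card_le_card
          (Finset.filter_subset_filter _ (Finset.filter_subset _ _))
      linarith
    have hpaths : ∑ a' ∈ S, codeg a a' ≤
        (((A ×ˢ B).filter fun p => (a, p.2) ∈ G ∧ p ∈ G ∧ (p.1, b) ∈ G).card : ℝ) := by
      rw [Finset.card_filter, Finset.sum_product, Nat.cast_sum]
      have hSA : S ⊆ A := ((Finset.filter_subset _ _).trans (Finset.filter_subset _ _)).trans hA₁A
      refine le_trans (Finset.sum_le_sum fun a' ha' => ?_)
        (Finset.sum_le_sum_of_subset_of_nonneg hSA fun a' _ _ => Nat.cast_nonneg _)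
      have hab' : (a', b) ∈ G :=
        (Finset.mem_filter.1 (Finset.mem_filter.1 ha').1).2
      simp only [hcodeg, hab', and_true, Finset.card_filter, le_refl]
    refine le_trans ?_ hpaths
    calc δ ^ 5 * n * m / 3072 = δ * (δ * n / 3) / 8 * (δ ^ 3 * m / 128) := by ring
      _ ≤ δ * l / 8 * (δ ^ 3 * m / 128) := by gcongr
      _ ≤ S.card * (δ ^ 3 * m / 128) := by gcongr
      _ ≤ ∑ a' ∈ S, codeg a a' := by
          rw [← nsmul_eq_mul, ← Finset.sum_const]
          exact Finset.sum_le_sum fun a' ha' => not_lt.1 (Finset.mem_filter.1 ha').2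

/-- The number of pairs on which a function takes the same value, as a sum over fibres. -/
theorem card_filter_apply_eq_apply {ι κ : Type*} [DecidableEq ι] [DecidableEq κ] (s : Finset ι)
    (f : ι → κ) :
    ((s ×ˢ s).filter fun p => f p.1 = f p.2).card =
      ∑ x ∈ s.image f, (s.filter fun i => f i = x).card ^ 2 := by
  rw [Finset.card_eq_sum_card_fiberwise (f := fun p => f p.1) (t := s.image f)]
  · refine Finset.sum_congr rfl fun x _ => ?_
    rw [sq, ← Finset.card_product]
    congr 1
    ext p
    simp only [Finset.mem_filter, Finset.mem_product]
    constructor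
    · rintro ⟨⟨⟨h1, h2⟩, h3⟩, h4⟩; exact ⟨⟨h1, h4⟩, h2, h3 ▸ h4⟩
    · rintro ⟨⟨h1, h2⟩, h3, h4⟩; exact ⟨⟨⟨h1, h3⟩, h2.trans h4.symm⟩, h2⟩
  · intro p hp
    simp only [Finset.coe_filter, Finset.mem_product, Set.mem_ofPred_eq] at hp
    exact Finset.mem_image_of_mem f hp.1.1

/-- Cauchy–Schwarz lower bound for the number of collisions of a function. -/
theorem card_sq_le_card_mul_card_filter_apply_eq {ι κ : Type*} [DecidableEq ι] [DecidableEq κ]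
    (s : Finset ι) (f : ι → κ) {u : Finset κ} (hu : ∀ i ∈ s, f i ∈ u) :
    s.card ^ 2 ≤ u.card * ((s ×ˢ s).filter fun p => f p.1 = f p.2).card := by
  have h := Finset.card_eq_sum_card_fiberwise (s := s) (f := f) (t := s.image f)
    fun i hi => Finset.mem_image_of_mem f hi
  rw [card_filter_apply_eq_apply, h]
  refine (sq_sum_le_card_mul_sum_sq (s := s.image f)
    (f := fun x => (s.filter fun i => f i = x).card)).trans ?_
  gcongr
  exact_mod_cast Finset.card_le_card (Finset.image_subset_iff.2 hu)

/-- Seen as the number of collisions of (x, y) ↦ x - ξy on A × A, the energy is open to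
Cauchy–Schwarz and to fibre counts. -/
theorem dilateEnergy_eq_card {𝔽 : Type*} [Field 𝔽] [DecidableEq 𝔽] (A : Finset 𝔽) (ξ : 𝔽) :
    dilateEnergy A ξ = (((A ×ˢ A) ×ˢ (A ×ˢ A)).filter
      fun p => p.1.1 - ξ * p.1.2 = p.2.1 - ξ * p.2.2).card := by
  refine Finset.card_nbij' (fun t => ((t.1, t.2.2.1), (t.2.1, t.2.2.2)))
    (fun p => (p.1.1, p.2.1, p.1.2, p.2.2)) ?_ ?_ (fun _ _ => rfl) (fun _ _ => rfl)
  · intro t ht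
    simp only [Finset.coe_filter, Finset.mem_product, Set.mem_ofPred_eq] at ht ⊢
    exact ⟨⟨⟨ht.1.1, ht.1.2.2.1⟩, ht.1.2.1, ht.1.2.2.2⟩, by linear_combination ht.2⟩
  · intro t ht
    simp only [Finset.coe_filter, Finset.mem_product, Set.mem_ofPred_eq] at ht ⊢
    exact ⟨⟨ht.1.1.1, ht.1.2.1, ht.1.1.2, ht.1.2.2⟩, by linear_combination ht.2⟩

/-- A set of pairs whose elements are joined by many paths of length three along popular
differences has few differences. -/
theorem card_sub_smul_mul_le_pow_three {𝔽 : Type*} [Field 𝔽] [DecidableEq 𝔽] {A A' B' D : Finset 𝔽}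
    {ξ : 𝔽} (hξ : ξ ≠ 0) {P : ℝ}
    (h : ∀ a ∈ A', ∀ b ∈ B', P ≤ (((A ×ˢ A).filter fun p =>
      a - ξ * p.2 ∈ D ∧ p.1 - ξ * p.2 ∈ D ∧ p.1 - ξ * b ∈ D).card : ℝ)) :
    ((A' - ξ • B').card : ℝ) * P ≤ (D.card : ℝ) ^ 3 := by
  -- One representation of each z is fixed, so that a triple which determines z also determines its
  -- endpoints a and b.
  have hz : ∀ z ∈ A' - ξ • B', ∃ p : 𝔽 × 𝔽, p.1 ∈ A' ∧ p.2 ∈ B' ∧ p.1 - ξ * p.2 = z := by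
    intro z hz
    obtain ⟨a, ha, y, hy, rfl⟩ := Finset.mem_sub.1 hz
    obtain ⟨b, hb, rfl⟩ := Finset.mem_smul_finset.1 hy
    exact ⟨(a, b), ha, hb, rfl⟩
  choose! w hwA hwB hw using hz
  set Q : 𝔽 → Finset (𝔽 × 𝔽) := fun z => (A ×ˢ A).filter fun p =>
    (w z).1 - ξ * p.2 ∈ D ∧ p.1 - ξ * p.2 ∈ D ∧ p.1 - ξ * (w z).2 ∈ D with hQ
  have h1 : ((A' - ξ • B').card : ℝ) * P ≤ (((A' - ξ • B').sigma Q).card : ℝ) := by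
    rw [Finset.card_sigma, Nat.cast_sum, ← nsmul_eq_mul, ← Finset.sum_const]
    exact Finset.sum_le_sum fun z hz => h _ (hwA z hz) _ (hwB z hz)
  refine h1.trans ?_
  have h2 : ((A' - ξ • B').sigma Q).card ≤ (D ×ˢ D ×ˢ D).card := by
    refine Finset.card_le_card_of_injOn
      (fun s => ((w s.1).1 - ξ * s.2.2, s.2.1 - ξ * s.2.2, s.2.1 - ξ * (w s.1).2)) ?_ ?_
    · rintro ⟨z, p⟩ hs
      simp only [hQ, Finset.coe_sigma, Set.mem_sigma_iff, Finset.mem_coe, Finset.mem_filter] at hs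
      simp only [Finset.coe_product, Set.mem_prod, Finset.mem_coe]
      exact hs.2.2
    · rintro ⟨z, p⟩ hs ⟨z', p'⟩ hs' heq
      simp only [Finset.coe_sigma, Set.mem_sigma_iff, Finset.mem_coe] at hs hs'
      simp only [Prod.mk.injEq] at heq
      -- Along a path the three differences telescope with alternating signs: (a - ξp₂) - (p₁ - ξp₂)
      -- + (p₁ - ξb) = a - ξb.
      have hzz : z = z' := by
        rw [← hw z hs.1, ← hw z' hs'.1]
        linear_combination heq.1 - heq.2.1 + heq.2.2
      subst hzz
      have e1 : p.2 = p'.2 := mul_left_cancel₀ hξ (by linear_combination -heq.1)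
      have e2 : p.1 = p'.1 := by linear_combination heq.2.2
      rw [Prod.ext e2 e1]
  rw [Finset.card_product, Finset.card_product] at h2
  calc _ ≤ ((D.card * (D.card * D.card) : ℕ) : ℝ) := by exact_mod_cast h2
    _ = _ := by push_cast; ring

/-- Dyadic pigeonholing of the energy: many pairs have popular differences. -/
theorem exists_dyadic_level {𝔽 : Type*} [Field 𝔽] [DecidableEq 𝔽] {A : Finset 𝔽}
    (hA : A.Nonempty) {ξ : 𝔽} {e : ℝ}
    (he : e * (Nat.log 2 A.card + 1 : ℕ) ≤ dilateEnergy A ξ) :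
    ∃ (D : Finset 𝔽) (t : ℝ), 0 < t ∧ t ≤ A.card ∧
      t * D.card ≤ (((A ×ˢ A).filter fun p => p.1 - ξ * p.2 ∈ D).card : ℝ) ∧
      e ≤ 2 * t * (((A ×ˢ A).filter fun p => p.1 - ξ * p.2 ∈ D).card : ℝ) := by
  set f : 𝔽 × 𝔽 → 𝔽 := fun p => p.1 - ξ * p.2 with hf
  set r : 𝔽 → ℕ := fun x => ((A ×ˢ A).filter fun p => f p = x).card with hr
  set U := (A ×ˢ A).image f with hU
  have hE : dilateEnergy A ξ = ∑ x ∈ U, r x ^ 2 := by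
    rw [dilateEnergy_eq_card]
    exact card_filter_apply_eq_apply (A ×ˢ A) f
  have hr1 : ∀ x ∈ U, r x ≠ 0 := by
    intro x hx
    obtain ⟨p, hp, rfl⟩ := Finset.mem_image.1 hx
    exact (Finset.card_pos.2 ⟨p, Finset.mem_filter.2 ⟨hp, rfl⟩⟩ :
      0 < ((A ×ˢ A).filter fun p' => f p' = f p).card).ne'
  have hrn : ∀ x, r x ≤ A.card := by
    intro x
    refine Finset.card_le_card_of_injOn Prod.snd ?_ ?_
    · intro p hp
      simp only [Finset.coe_filter, Finset.mem_product, Set.mem_ofPred_eq] at hp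
      exact hp.1.2
    · intro p hp p' hp' h
      simp only [hf, Finset.coe_filter, Finset.mem_product, Set.mem_ofPred_eq] at hp hp'
      refine Prod.ext ?_ h
      have : p.1 - ξ * p.2 = p'.1 - ξ * p'.2 := hp.2.trans hp'.2.symm
      rw [h] at this
      exact sub_left_injective this
  have hmaps : ∀ x ∈ U, Nat.log 2 (r x) ∈ Finset.range (Nat.log 2 A.card + 1) := fun x _ =>
    Finset.mem_range.2 (Nat.lt_succ_of_le (Nat.log_mono_right (hrn x)))
  -- Representation counts lie between 1 and |A|, so there are at most log₂|A| + 1 dyadic levels.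
  -- The level with the largest share of the energy is kept, with t = 2^j.
  obtain ⟨j, hj, hje⟩ : ∃ j ∈ Finset.range (Nat.log 2 A.card + 1),
      e ≤ ∑ x ∈ U.filter (fun x => Nat.log 2 (r x) = j), (r x : ℝ) ^ 2 := by
    refine Finset.exists_le_of_sum_le ⟨0, by simp⟩ ?_
    rw [Finset.sum_fiberwise_of_maps_to hmaps, Finset.sum_const, Finset.card_range, nsmul_eq_mul,
      mul_comm]
    refine he.trans (le_of_eq ?_)
    rw [hE]; push_cast; rfl
  set D := U.filter (fun x => Nat.log 2 (r x) = j) with hD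
  have hG : ((A ×ˢ A).filter fun p => f p ∈ D).card = ∑ x ∈ D, r x := by
    rw [Finset.card_eq_sum_card_fiberwise (f := f) (t := D)]
    · refine Finset.sum_congr rfl fun x hx => ?_
      rw [hr, Finset.filter_filter]
      congr 1
      ext p
      simp only [Finset.mem_filter]
      constructor
      · rintro ⟨h1, _, h2⟩; exact ⟨h1, h2⟩
      · rintro ⟨h1, h2⟩; exact ⟨h1, h2 ▸ hx, h2⟩
    · intro p hp
      simp only [Finset.coe_filter, Set.mem_ofPred_eq] at hp
      exact hp.2
  have hlow : ∀ x ∈ D, 2 ^ j ≤ r x := by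
    intro x hx
    obtain ⟨hx1, rfl⟩ := Finset.mem_filter.1 hx
    exact Nat.pow_log_le_self 2 (hr1 x hx1)
  have hupp : ∀ x ∈ D, r x ≤ 2 * 2 ^ j := by
    intro x hx
    obtain ⟨hx1, rfl⟩ := Finset.mem_filter.1 hx
    have := (Nat.lt_pow_succ_log_self (b := 2) (by norm_num) (r x)).le
    rwa [pow_succ, mul_comm] at this
  · refine ⟨D, 2 ^ j, by positivity, ?_, ?_, ?_⟩
    · have h1 : 2 ^ j ≤ A.card := by
        refine (Nat.pow_le_pow_right (by norm_num) (Nat.lt_succ_iff.1 (Finset.mem_range.1 hj))).trans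
          (Nat.pow_log_le_self 2 hA.card_pos.ne')
      exact_mod_cast h1
    · rw [hG, mul_comm, ← nsmul_eq_mul, ← Finset.sum_const, Nat.cast_sum]
      exact Finset.sum_le_sum fun x hx => by exact_mod_cast hlow x hx
    · refine hje.trans ?_
      rw [hG, Nat.cast_sum, Finset.mul_sum]
      refine Finset.sum_le_sum fun x hx => ?_
      rw [sq]
      gcongr
      exact_mod_cast hupp x hx

/-- The graph lemma is applied to the pairs whose difference lies in one dyadic level D. The height
t and the number g of edges are kept as separate parameters: with |D| ≤ g/t and n³ ≤ 2tgKJ, where J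
counts the levels, the final loss is only cubic in KJ. -/
theorem exists_subsets_card_sub_smul_le {𝔽 : Type*} [Field 𝔽] [DecidableEq 𝔽] {A : Finset 𝔽}
    (hA : A.Nonempty) {ξ : 𝔽} (hξ : ξ ≠ 0) {K κ : ℝ} (hK : 0 < K)
    (hκ : 32 * K * (Nat.log 2 A.card + 1 : ℕ) ≤ κ)
    (hE : (A.card : ℝ) ^ 3 / K ≤ dilateEnergy A ξ) :
    ∃ A' ⊆ A, ∃ B' ⊆ A, (A.card : ℝ) / κ ≤ A'.card ∧ (A.card : ℝ) / κ ≤ B'.card ∧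
      ((A' - ξ • B').card : ℝ) ≤ κ ^ 3 * A.card := by
  set J : ℝ := ((Nat.log 2 A.card + 1 : ℕ) : ℝ) with hJ
  have hJ1 : 1 ≤ J := by rw [hJ]; exact_mod_cast Nat.le_add_left 1 _
  have hn : (1 : ℝ) ≤ A.card := by exact_mod_cast hA.card_pos
  obtain ⟨D, t, ht, htn, htD, hG⟩ := exists_dyadic_level hA (ξ := ξ)
    (e := (A.card : ℝ) ^ 3 / (K * J)) (by rw [← hJ]; convert hE using 1; field_simp)
  set G := (A ×ˢ A).filter fun p => p.1 - ξ * p.2 ∈ D with hGdef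
  have hGn : (G.card : ℝ) ≤ (A.card : ℝ) ^ 2 := by
    have : G.card ≤ (A ×ˢ A).card := Finset.card_filter_le _ _
    rw [Finset.card_product] at this
    rw [sq]; exact_mod_cast this
  set n : ℝ := (A.card : ℝ) with hn_def
  set g : ℝ := (G.card : ℝ) with hg_def
  have hg : 0 < g := by
    have : 0 < n ^ 3 / (K * J) := by positivity
    by_contra hg0
    nlinarith
  obtain ⟨A', hA', B', hB', hcA, hcB, hpath⟩ := exists_subsets_many_paths_three hA hA
    (G := G) (Finset.filter_subset _ _) (δ := g / n ^ 2) (by positivity)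
    (le_of_eq (by rw [← hn_def, ← hg_def]; field_simp))
  rw [← hn_def] at hcA hcB hpath
  have hKJ : n ^ 3 ≤ 2 * t * g * (K * J) := by
    rwa [div_le_iff₀ (by positivity)] at hG
  have hδ : n ≤ 2 * (K * J) * (g / n) := by
    rw [mul_div_assoc', le_div_iff₀ (by positivity)]
    have h1 : n ^ 3 ≤ 2 * n * g * (K * J) := hKJ.trans (by gcongr)
    have h2 : n * (n * n) ≤ n * (2 * (K * J) * g) := by linarith
    exact le_of_mul_le_mul_left h2 (by positivity)
  have hκ0 : 0 < κ := lt_of_lt_of_le (by positivity) hκ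
  have hsize : n / κ ≤ g / n ^ 2 * n / 6 := by
    have h1 : n / κ ≤ n / (32 * K * J) := div_le_div_of_nonneg_left (by positivity) (by positivity) hκ
    refine h1.trans ?_
    rw [div_le_iff₀ (by positivity)]
    have : g / n ^ 2 * n / 6 * (32 * K * J) = 2 * (K * J) * (g / n) * (32 / 12) := by
      field_simp; ring
    rw [this]
    have : 0 ≤ 2 * (K * J) * (g / n) := by positivity
    linarith
  refine ⟨A', hA', B', hB', hsize.trans hcA, ?_, ?_⟩
  · refine hsize.trans (le_trans ?_ hcB)
    have : 0 ≤ g / n ^ 2 * n := by positivity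
    linarith
  have hcard := card_sub_smul_mul_le_pow_three (A := A) (A' := A') (B' := B') (D := D) hξ
    (P := (g / n ^ 2) ^ 5 * n * n / 3072) (by
      intro a ha b hb
      refine (hpath a ha b hb).trans ?_
      have : ((A ×ˢ A).filter fun p => (a, p.2) ∈ G ∧ p ∈ G ∧ (p.1, b) ∈ G) ⊆
          (A ×ˢ A).filter fun p => a - ξ * p.2 ∈ D ∧ p.1 - ξ * p.2 ∈ D ∧ p.1 - ξ * b ∈ D := by
        intro p hp
        simp only [hGdef, Finset.mem_filter] at hp ⊢
        exact ⟨hp.1, hp.2.1.2, hp.2.2.1.2, hp.2.2.2.2⟩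
      exact_mod_cast Finset.card_le_card this)
  set S : ℝ := ((A' - ξ • B').card : ℝ) with hS
  have hS0 : 0 ≤ S := Nat.cast_nonneg _
  have hD : (D.card : ℝ) ^ 3 ≤ (g / t) ^ 3 := by
    gcongr; rw [le_div_iff₀ ht]; linarith
  -- clear denominators: `S g² t³ ≤ 3072 n⁸`
  have h1 : S * (g ^ 2 * t ^ 3) ≤ 3072 * n ^ 8 := by
    have h2 := hcard.trans hD
    have h3 : S * ((g / n ^ 2) ^ 5 * n * n / 3072) * (3072 * n ^ 8 * t ^ 3 / g ^ 3) ≤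
        (g / t) ^ 3 * (3072 * n ^ 8 * t ^ 3 / g ^ 3) := by gcongr
    have e1 : S * ((g / n ^ 2) ^ 5 * n * n / 3072) * (3072 * n ^ 8 * t ^ 3 / g ^ 3) =
        S * (g ^ 2 * t ^ 3) := by field_simp
    have e2 : (g / t) ^ 3 * (3072 * n ^ 8 * t ^ 3 / g ^ 3) = 3072 * n ^ 8 := by field_simp
    rwa [e1, e2] at h3
  have h4 : n ^ 9 ≤ 8 * (K * J) ^ 3 * (g ^ 2 * t ^ 3) * n ^ 2 := by
    calc n ^ 9 = (n ^ 3) ^ 3 := by ring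
      _ ≤ (2 * t * g * (K * J)) ^ 3 := by gcongr
      _ = 8 * (K * J) ^ 3 * (g ^ 2 * t ^ 3) * g := by ring
      _ ≤ _ := by gcongr
  -- This is where 32 in the hypothesis on κ comes from: 3072 · 8 = 24576 ≤ 32³.
  have h5 : 3072 * 8 * (K * J) ^ 3 ≤ κ ^ 3 := by
    calc 3072 * 8 * (K * J) ^ 3 ≤ (32 * K * J) ^ 3 := by
          have : 0 ≤ (K * J) ^ 3 := by positivity
          nlinarith
      _ ≤ κ ^ 3 := by gcongr
  have h6 : S * n ^ 9 ≤ κ ^ 3 * n * n ^ 9 := by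
    calc S * n ^ 9 ≤ S * (8 * (K * J) ^ 3 * (g ^ 2 * t ^ 3) * n ^ 2) := by gcongr
      _ = 8 * (K * J) ^ 3 * n ^ 2 * (S * (g ^ 2 * t ^ 3)) := by ring
      _ ≤ 8 * (K * J) ^ 3 * n ^ 2 * (3072 * n ^ 8) := by gcongr
      _ = (3072 * 8 * (K * J) ^ 3) * n * n ^ 9 := by ring
      _ ≤ _ := by gcongr
  exact le_of_mul_le_mul_right h6 (by positivity)

/-! ### Calculus of coverings by translates -/

section Covering

variable {𝔽 : Type*} [Field 𝔽]

theorem CovByVAdd.add {S S' P P' : Set 𝔽} {a b : ℝ} (h : CovByVAdd 𝔽 a S P)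
    (h' : CovByVAdd 𝔽 b S' P') : CovByVAdd 𝔽 (a * b) (S + S') (P + P') := by
  classical
  have ha := h.nonneg
  obtain ⟨T, hT, hST⟩ := h
  obtain ⟨T', hT', hST'⟩ := h'
  refine ⟨T + T', ?_, ?_⟩
  · calc ((T + T').card : ℝ) ≤ T.card * T'.card := by exact_mod_cast Finset.card_add_le
      _ ≤ a * b := by gcongr
  · simp only [vadd_eq_add, Finset.coe_add] at *
    calc S + S' ⊆ (↑T + P) + (↑T' + P') := Set.add_subset_add hST hST'
      _ = _ := add_add_add_comm _ _ _ _

theorem CovByVAdd.smul_left {S P : Set 𝔽} {a : ℝ} (y : 𝔽) (h : CovByVAdd 𝔽 a S P) :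
    CovByVAdd 𝔽 a (y • S) (y • P) := by
  classical
  obtain ⟨T, hT, hST⟩ := h
  refine ⟨y • T, ?_, ?_⟩
  · exact le_trans (by exact_mod_cast Finset.card_image_le) hT
  · simp only [vadd_eq_add, Finset.coe_smul_finset] at *
    rw [← smul_add]
    exact Set.smul_set_mono hST

theorem CovByVAdd.add_of_add {S S' H : Set 𝔽} {a b c : ℝ} (h : CovByVAdd 𝔽 a S H)
    (h' : CovByVAdd 𝔽 b S' H) (hH : CovByVAdd 𝔽 c (H + H) H) :
    CovByVAdd 𝔽 (a * b * c) (S + S') H :=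
  (h.add h').trans hH

/-- Since H is symmetric, (x - y)H ⊆ xH + yH. -/
theorem CovByVAdd.sub_smul {H : Set 𝔽} (hneg : -H = H) {a b c : ℝ} {x y : 𝔽}
    (h : CovByVAdd 𝔽 a (x • H) H) (h' : CovByVAdd 𝔽 b (y • H) H)
    (hH : CovByVAdd 𝔽 c (H + H) H) : CovByVAdd 𝔽 (a * b * c) ((x - y) • H) H := by
  refine (h.add_of_add h' hH).subset_left ?_
  rintro _ ⟨z, hz, rfl⟩
  refine ⟨x • z, Set.smul_mem_smul_set hz, y • (-z), Set.smul_mem_smul_set (hneg ▸ Set.neg_mem_neg.2 hz), ?_⟩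
  simp only [smul_eq_mul]; ring

theorem CovByVAdd.card_le [DecidableEq 𝔽] {S H : Finset 𝔽} {a : ℝ}
    (h : CovByVAdd 𝔽 a (S : Set 𝔽) (H : Set 𝔽)) :
    (S.card : ℝ) ≤ a * H.card := by
  obtain ⟨T, hT, hST⟩ := h
  have : S ⊆ T + H := by
    rw [← Finset.coe_subset, Finset.coe_add]; exact hST
  calc (S.card : ℝ) ≤ T.card * H.card := by
        exact_mod_cast (Finset.card_le_card this).trans Finset.card_add_le
    _ ≤ a * H.card := by gcongr

/-- Ruzsa covering, in the language of `CovByVAdd`. -/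
theorem covByVAdd_sub_of_card_sub_le [DecidableEq 𝔽] {S B : Finset 𝔽} (hB : B.Nonempty) {a : ℝ}
    (h : ((S - B).card : ℝ) ≤ a * B.card) :
    CovByVAdd 𝔽 a (S : Set 𝔽) ((B - B : Finset 𝔽) : Set 𝔽) := by
  obtain ⟨T, -, hT, hST⟩ := Finset.ruzsa_covering_add (K := a) (A := S) (B := -B) hB.neg
    (by rwa [Finset.card_neg, ← sub_eq_add_neg])
  refine ⟨T, hT, ?_⟩
  rw [vadd_eq_add, ← Finset.coe_add, Finset.coe_subset]
  rwa [sub_neg_eq_add, neg_add_eq_sub] at hST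

end Covering

/-! ### A single set almost stable under many dilations -/

section StableSet

variable {𝔽 : Type*} [Field 𝔽] [DecidableEq 𝔽]

/-- Pigeonholing: from rectangles in `A × A` with density at least `κ⁻²`, many meet a fixed one
in density at least `κ⁻⁴ / 2`. -/
theorem exists_many_large_inter {ι α : Type*} [DecidableEq α] {X : Finset ι} (hX : X.Nonempty)
    {Ω : Finset α} {P : ι → Finset α} (hP : ∀ ξ ∈ X, P ξ ⊆ Ω) {d : ℝ} (hd : 0 ≤ d)
    (hcard : ∀ ξ ∈ X, d * Ω.card ≤ ((P ξ).card : ℝ)) (hΩ : Ω.Nonempty) :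
    ∃ ξ₀ ∈ X, d ^ 2 / 2 * X.card ≤
      ((X.filter fun ξ => d ^ 2 / 2 * Ω.card ≤ ((P ξ ∩ P ξ₀).card : ℝ)).card : ℝ) := by
  have hN : (0 : ℝ) < Ω.card := by exact_mod_cast hΩ.card_pos
  have hXc : (0 : ℝ) < X.card := by exact_mod_cast hX.card_pos
  have h1 : ∑ ξ ∈ X, ((P ξ).card : ℝ) = ∑ ω ∈ Ω, ((X.filter fun ξ => ω ∈ P ξ).card : ℝ) := by
    simp only [Finset.card_filter, Nat.cast_sum]
    rw [Finset.sum_comm]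
    refine Finset.sum_congr rfl fun ξ hξ => ?_
    rw [← Nat.cast_sum, ← Finset.card_filter, Finset.filter_mem_eq_inter,
      Finset.inter_eq_right.2 (hP ξ hξ)]
  have h2 : ∑ ξ₀ ∈ X, ∑ ξ ∈ X, ((P ξ ∩ P ξ₀).card : ℝ) =
      ∑ ω ∈ Ω, ((X.filter fun ξ => ω ∈ P ξ).card : ℝ) ^ 2 := by
    have : ∀ ξ₀ ∈ X, ∀ ξ ∈ X, ((P ξ ∩ P ξ₀).card : ℝ) =
        ∑ ω ∈ Ω, (if ω ∈ P ξ then 1 else 0) * (if ω ∈ P ξ₀ then (1 : ℝ) else 0) := by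
      intro ξ₀ _ ξ hξ
      have : P ξ ∩ P ξ₀ = Ω.filter fun ω => ω ∈ P ξ ∧ ω ∈ P ξ₀ := by
        ext ω
        simp only [Finset.mem_inter, Finset.mem_filter]
        exact ⟨fun h => ⟨hP ξ hξ h.1, h⟩, fun h => h.2⟩
      rw [this, Finset.card_filter]
      push_cast
      refine Finset.sum_congr rfl fun ω _ => ?_
      by_cases h : ω ∈ P ξ <;> by_cases h' : ω ∈ P ξ₀ <;> simp [h, h']
    rw [Finset.sum_congr rfl fun ξ₀ h₀ => Finset.sum_congr rfl fun ξ h => this ξ₀ h₀ ξ h]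
    simp only [sq, Finset.card_filter, Nat.cast_sum, Finset.sum_mul_sum]
    rw [Finset.sum_congr rfl fun _ _ => Finset.sum_comm, Finset.sum_comm]
    refine Finset.sum_congr rfl fun ω _ => ?_
    rw [Finset.sum_comm]
    push_cast
    rfl
  have h3 : d * X.card * Ω.card ≤ ∑ ξ ∈ X, ((P ξ).card : ℝ) := by
    calc d * X.card * Ω.card = ∑ ξ ∈ X, d * Ω.card := by
          rw [Finset.sum_const, nsmul_eq_mul]; ring
      _ ≤ _ := Finset.sum_le_sum hcard
  have h4 : d ^ 2 * X.card ^ 2 * Ω.card ≤ ∑ ω ∈ Ω, ((X.filter fun ξ => ω ∈ P ξ).card : ℝ) ^ 2 := by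
    have := sq_sum_le_card_mul_sum_sq (s := Ω) (f := fun ω => ((X.filter fun ξ => ω ∈ P ξ).card : ℝ))
    rw [← h1] at this
    have h5 : (d * X.card * Ω.card) ^ 2 ≤ _ := (pow_le_pow_left₀ (by positivity) h3 2).trans this
    refine le_of_mul_le_mul_left (a := (Ω.card : ℝ)) ?_ hN
    refine le_trans (le_of_eq ?_) h5
    ring
  obtain ⟨ξ₀, hξ₀, h6⟩ : ∃ ξ₀ ∈ X, d ^ 2 * X.card * Ω.card ≤ ∑ ξ ∈ X, ((P ξ ∩ P ξ₀).card : ℝ) := by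
    refine Finset.exists_le_of_sum_le hX ?_
    rw [h2, Finset.sum_const, nsmul_eq_mul]
    refine le_trans (le_of_eq ?_) h4
    ring
  refine ⟨ξ₀, hξ₀, ?_⟩
  have h7 := Finset.sum_filter_add_sum_filter_not X
    (fun ξ => d ^ 2 / 2 * Ω.card ≤ ((P ξ ∩ P ξ₀).card : ℝ)) fun ξ => ((P ξ ∩ P ξ₀).card : ℝ)
  have h8 : ∑ ξ ∈ X.filter (fun ξ => ¬ d ^ 2 / 2 * Ω.card ≤ ((P ξ ∩ P ξ₀).card : ℝ)),
      ((P ξ ∩ P ξ₀).card : ℝ) ≤ X.card * (d ^ 2 / 2 * Ω.card) := by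
    refine (Finset.sum_le_sum fun ξ h => (not_le.1 (Finset.mem_filter.1 h).2).le).trans ?_
    rw [Finset.sum_const, nsmul_eq_mul]
    gcongr
    exact Finset.filter_subset _ _
  have h9 : ∑ ξ ∈ X.filter (fun ξ => d ^ 2 / 2 * Ω.card ≤ ((P ξ ∩ P ξ₀).card : ℝ)),
      ((P ξ ∩ P ξ₀).card : ℝ) ≤
      ((X.filter fun ξ => d ^ 2 / 2 * Ω.card ≤ ((P ξ ∩ P ξ₀).card : ℝ)).card : ℝ) * Ω.card := by
    rw [← nsmul_eq_mul, ← Finset.sum_const]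
    refine Finset.sum_le_sum fun ξ h => ?_
    exact_mod_cast Finset.card_le_card
      (Finset.inter_subset_left.trans (hP ξ (Finset.mem_filter.1 h).1))
  refine le_of_mul_le_mul_right (a := (Ω.card : ℝ)) ?_ hN
  linarith

theorem card_smul_sub_smul {ξ : 𝔽} (hξ : ξ ≠ 0) (S T : Finset 𝔽) :
    (ξ • S - ξ • T).card = (S - T).card := by
  have : ξ • S - ξ • T = ξ • (S - T) := by
    rw [← Finset.coe_inj]
    push_cast
    rw [sub_eq_add_neg, sub_eq_add_neg, ← Set.smul_set_neg, ← smul_add]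
  rw [this]
  exact Finset.card_smul_finset (Units.mk0 ξ hξ) _

/-- Plünnecke's inequality for the difference set of `2B - 2B` and `B`. -/
theorem card_sub_add_sub_sub_le {A : Finset 𝔽} (hA : A.Nonempty) (B : Finset 𝔽) :
    ((B - B + (B - B) - B).card : ℝ) ≤ (((A - B).card : ℝ) / A.card) ^ 5 * A.card := by
  have h := Finset.pluennecke_ruzsa_inequality_nsmul_sub_nsmul_sub hA B 2 3
  have e : B - B + (B - B) - B = 2 • B - 3 • B := by
    rw [two_nsmul, succ_nsmul, two_nsmul]
    simp only [sub_eq_add_neg, neg_add]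
    ac_rfl
  rw [e]
  have h' := (NNRat.cast_le (K := ℝ)).2 h
  push_cast at h'
  exact h'

/-- Transferring a bound on `A₂ - ξ B₂` to a bound on `ξ B₀ - ξ₀ B₀` through large intersections. -/
theorem card_smul_sub_smul_le {A₀ B₀ A₂ B₂ : Finset 𝔽} {ξ ξ₀ : 𝔽} (hξ₀ : ξ₀ ≠ 0) (hξ : ξ ≠ 0)
    {κ n : ℝ} (hκ : 0 < κ) (hn : 0 < n)
    (hBB : ((ξ₀ • B₀ - ξ₀ • B₀).card : ℝ) ≤ κ ^ 7 * n)
    (hBA : ((ξ₀ • B₀ - A₀).card : ℝ) ≤ κ ^ 3 * n)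
    (h₂ : ((A₂ - ξ • B₂).card : ℝ) ≤ κ ^ 3 * n)
    (hcard : (1 / κ ^ 2) ^ 2 / 2 * (n * n) ≤ ((A₂ ∩ A₀).card : ℝ) * ((B₂ ∩ B₀).card : ℝ)) :
    ((ξ • B₀ - ξ₀ • B₀).card : ℝ) ≤ 2 * κ ^ 17 * n := by
  set A₁ := A₂ ∩ A₀ with hA₁
  set B₁ := B₂ ∩ B₀ with hB₁
  have hcardB₁ : (ξ • B₁).card = B₁.card := Finset.card_smul_finset (Units.mk0 ξ hξ) B₁
  have hBB' : ((ξ • B₀ - ξ • B₁).card : ℝ) ≤ κ ^ 7 * n := by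
    refine le_trans ?_ hBB
    rw [card_smul_sub_smul hξ, card_smul_sub_smul hξ₀]
    exact_mod_cast Finset.card_le_card (Finset.sub_subset_sub_left Finset.inter_subset_right)
  have hA1B1 : ((A₁ - ξ • B₁).card : ℝ) ≤ κ ^ 3 * n := by
    refine le_trans ?_ h₂
    have hs : ξ • B₁ ⊆ ξ • B₂ := Finset.smul_finset_subset_smul_finset Finset.inter_subset_left
    have hsub : A₁ - ξ • B₁ ⊆ A₂ - ξ • B₂ := Finset.sub_subset_sub Finset.inter_subset_left hs
    exact Nat.cast_le.2 (Finset.card_le_card hsub)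
  have hBA1 : ((ξ₀ • B₀ - A₁).card : ℝ) ≤ κ ^ 3 * n := by
    refine le_trans ?_ hBA
    exact_mod_cast Finset.card_le_card (Finset.sub_subset_sub_left Finset.inter_subset_right)
  -- Two Ruzsa triangle inequalities lead from ξB₀ through ξB₁ to A₁, then through A₁ to ξ₀B₀.
  -- Dividing by |A₁||B₁| ≥ n²/(2κ⁴) gives the exponent 7 + 3 + 3 + 4 = 17.
  have t1 : ((ξ • B₀ - A₁).card : ℝ) * B₁.card ≤ κ ^ 7 * n * (κ ^ 3 * n) := by
    rw [← hcardB₁]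
    have h : ((ξ • B₀ - A₁).card : ℝ) * (ξ • B₁).card ≤
        (ξ • B₀ - ξ • B₁).card * (A₁ - ξ • B₁).card := by
      exact_mod_cast Finset.ruzsa_triangle_inequality_sub_sub_sub (ξ • B₀) (ξ • B₁) A₁
    exact h.trans (mul_le_mul hBB' hA1B1 (Nat.cast_nonneg _) (by positivity))
  have t2 : ((ξ • B₀ - ξ₀ • B₀).card : ℝ) * A₁.card ≤ (ξ • B₀ - A₁).card * (κ ^ 3 * n) := by
    have h : ((ξ • B₀ - ξ₀ • B₀).card : ℝ) * A₁.card ≤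
        (ξ • B₀ - A₁).card * (ξ₀ • B₀ - A₁).card := by
      exact_mod_cast Finset.ruzsa_triangle_inequality_sub_sub_sub (ξ • B₀) A₁ (ξ₀ • B₀)
    exact h.trans (mul_le_mul le_rfl hBA1 (Nat.cast_nonneg _) (Nat.cast_nonneg _))
  refine le_of_mul_le_mul_right (a := (1 / κ ^ 2) ^ 2 / 2 * (n * n)) ?_ (by positivity)
  calc _ ≤ ((ξ • B₀ - ξ₀ • B₀).card : ℝ) * (A₁.card * B₁.card) := by gcongr
    _ = ((ξ • B₀ - ξ₀ • B₀).card : ℝ) * A₁.card * B₁.card := by ring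
    _ ≤ (ξ • B₀ - A₁).card * (κ ^ 3 * n) * B₁.card := by gcongr
    _ = (ξ • B₀ - A₁).card * B₁.card * (κ ^ 3 * n) := by ring
    _ ≤ κ ^ 7 * n * (κ ^ 3 * n) * (κ ^ 3 * n) := by gcongr
    _ = _ := by field_simp

/-- If many dilates `ξ` admit dense subsets `A', B'` of `A` with few differences `a - ξ b`, then a
single set `ξ₀ B₀` with `B₀ ⊆ A` has small doubling and few differences with many of its dilates. -/
theorem exists_set_card_smul_sub_le {A X : Finset 𝔽} (hA : A.Nonempty) (hX : X.Nonempty)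
    (h0 : (0 : 𝔽) ∉ X) {κ : ℝ} (hκ : 1 ≤ κ)
    (h : ∀ ξ ∈ X, ∃ A' ⊆ A, ∃ B' ⊆ A, (A.card : ℝ) / κ ≤ A'.card ∧ (A.card : ℝ) / κ ≤ B'.card ∧
      ((A' - ξ • B').card : ℝ) ≤ κ ^ 3 * A.card) :
    ∃ ξ₀ ∈ X, ∃ B₀ ⊆ A, ∃ B Y : Finset 𝔽, B = ξ₀ • B₀ ∧ (1 : 𝔽) ∈ Y ∧ (0 : 𝔽) ∉ Y ∧
      (X.card : ℝ) ≤ 2 * κ ^ 4 * Y.card ∧ (A.card : ℝ) ≤ κ * B.card ∧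
      ((B - B).card : ℝ) ≤ κ ^ 7 * A.card ∧
      (∀ η ∈ Y, ((η • B - B).card : ℝ) ≤ 2 * κ ^ 18 * B.card) ∧
      ((B - B + (B - B) - B).card : ℝ) ≤ κ ^ 20 * B.card := by
  have hκ0 : 0 < κ := by linarith
  have hn : (0 : ℝ) < A.card := by exact_mod_cast hA.card_pos
  choose! A' hA' B' hB' hcA hcB hsub using h
  obtain ⟨ξ₀, hξ₀, hmany⟩ := exists_many_large_inter hX (Ω := A ×ˢ A)
    (P := fun ξ => A' ξ ×ˢ B' ξ) (fun ξ hξ => Finset.product_subset_product (hA' ξ hξ) (hB' ξ hξ))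
    (d := 1 / κ ^ 2) (by positivity) (fun ξ hξ => by
      rw [Finset.card_product, Finset.card_product]
      push_cast
      calc 1 / κ ^ 2 * ((A.card : ℝ) * A.card) = A.card / κ * (A.card / κ) := by
            field_simp
        _ ≤ _ := mul_le_mul (hcA ξ hξ) (hcB ξ hξ) (by positivity) (by positivity)) (hA.product hA)
  set n : ℝ := (A.card : ℝ) with hn_def
  set X₀ := X.filter fun ξ => (1 / κ ^ 2) ^ 2 / 2 * ((A ×ˢ A).card : ℝ) ≤
    (((A' ξ ×ˢ B' ξ) ∩ (A' ξ₀ ×ˢ B' ξ₀)).card : ℝ) with hX₀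
  have hξ₀0 : ξ₀ ≠ 0 := fun h => h0 (h ▸ hξ₀)
  set B := ξ₀ • B' ξ₀ with hB
  have hBcard : B.card = (B' ξ₀).card := Finset.card_smul_finset (Units.mk0 ξ₀ hξ₀0) (B' ξ₀)
  have hBn : n / κ ≤ (B.card : ℝ) := by rw [hBcard]; exact hcB ξ₀ hξ₀
  have hBpos : (0 : ℝ) < B.card := lt_of_lt_of_le (by positivity) hBn
  have hBne : B.Nonempty := Finset.card_pos.1 (by exact_mod_cast hBpos)
  have hA0n := hcA ξ₀ hξ₀
  have hA0pos : (0 : ℝ) < (A' ξ₀).card := lt_of_lt_of_le (by positivity) hA0n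
  have hA0ne : (A' ξ₀).Nonempty := Finset.card_pos.1 (by exact_mod_cast hA0pos)
  have hAB : ((A' ξ₀ - B).card : ℝ) ≤ κ ^ 3 * n := hsub ξ₀ hξ₀
  have hBA : ((B - A' ξ₀).card : ℝ) ≤ κ ^ 3 * n := by
    rw [← Finset.card_neg, neg_sub]; exact hAB
  have hBB : ((B - B).card : ℝ) ≤ κ ^ 7 * n := by
    have h1 : ((B - B).card : ℝ) * (A' ξ₀).card ≤
        (B - A' ξ₀).card * (B - A' ξ₀).card := by
      exact_mod_cast Finset.ruzsa_triangle_inequality_sub_sub_sub B (A' ξ₀) B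
    have h2 : ((B - B).card : ℝ) * (n / κ) ≤ κ ^ 3 * n * (κ ^ 3 * n) :=
      calc _ ≤ ((B - B).card : ℝ) * (A' ξ₀).card := by gcongr
        _ ≤ _ := h1.trans (mul_le_mul hBA hBA (by positivity) (by positivity))
    refine le_of_mul_le_mul_right (a := n / κ) (h2.trans (le_of_eq ?_)) (by positivity)
    field_simp
  -- Dividing the good dilates by ξ₀ puts 1 into Y, as the pivot argument requires.
  refine ⟨ξ₀, hξ₀, B' ξ₀, hB' ξ₀ hξ₀, B, X₀.image fun ξ => ξ * ξ₀⁻¹, rfl, ?_, ?_, ?_, ?_, hBB,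
    ?_, ?_⟩
  · refine Finset.mem_image.2 ⟨ξ₀, Finset.mem_filter.2 ⟨hξ₀, ?_⟩, mul_inv_cancel₀ hξ₀0⟩
    rw [Finset.inter_self, Finset.card_product, Finset.card_product]
    push_cast
    calc (1 / κ ^ 2) ^ 2 / 2 * ((A.card : ℝ) * A.card)
        ≤ (1 / κ ^ 2) * ((A.card : ℝ) * A.card) := by
          refine mul_le_mul_of_nonneg_right ?_ (by positivity)
          have h1 : (1 / κ ^ 2) ≤ 1 := by
            rw [div_le_one (by positivity)]; exact one_le_pow₀ hκ
          have h2 : 0 < 1 / κ ^ 2 := by positivity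
          nlinarith
      _ = n / κ * (n / κ) := by rw [← hn_def]; field_simp
      _ ≤ _ := mul_le_mul hA0n (hcB ξ₀ hξ₀) (by positivity) (by positivity)
  · intro h
    obtain ⟨ξ, hξ, h⟩ := Finset.mem_image.1 h
    rcases mul_eq_zero.1 h with h | h
    · exact h0 (h ▸ (Finset.mem_filter.1 hξ).1)
    · exact inv_ne_zero hξ₀0 h
  · rw [Finset.card_image_of_injective _ (mul_left_injective₀ (inv_ne_zero hξ₀0))]
    calc (X.card : ℝ) = 2 * κ ^ 4 * ((1 / κ ^ 2) ^ 2 / 2 * X.card) := by field_simp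
      _ ≤ _ := by gcongr
  · rwa [div_le_iff₀' hκ0] at hBn
  · intro η hη
    obtain ⟨ξ, hξ, rfl⟩ := Finset.mem_image.1 hη
    obtain ⟨hξX, hξP⟩ := Finset.mem_filter.1 hξ
    have hηB : (ξ * ξ₀⁻¹) • B = ξ • B' ξ₀ := by
      rw [hB, smul_smul, inv_mul_cancel_right₀ hξ₀0]
    rw [hηB]
    rw [Finset.product_inter_product, Finset.card_product, Finset.card_product] at hξP
    push_cast at hξP
    refine (card_smul_sub_smul_le hξ₀0 (fun h => h0 (h ▸ hξX)) hκ0 hn hBB hBA (hsub ξ hξX)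
      hξP).trans ?_
    rw [div_le_iff₀' hκ0] at hBn
    calc 2 * κ ^ 17 * n ≤ 2 * κ ^ 17 * (κ * B.card) := by gcongr
      _ = _ := by ring
  · refine (card_sub_add_sub_sub_le hA0ne B).trans ?_
    set a : ℝ := ((A' ξ₀).card : ℝ) with ha
    have hBn' : n ≤ κ * B.card := by rwa [div_le_iff₀' hκ0] at hBn
    have hna : n ≤ κ * a := by rwa [div_le_iff₀' hκ0] at hA0n
    calc (((A' ξ₀ - B).card : ℝ) / a) ^ 5 * a ≤ (κ ^ 3 * n / a) ^ 5 * a := by gcongr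
      _ = κ ^ 15 * n ^ 4 * n / a ^ 4 := by field_simp
      _ ≤ κ ^ 15 * (κ * a) ^ 4 * (κ * B.card) / a ^ 4 := by gcongr
      _ = _ := by field_simp

end StableSet

/-! ### Energies with dilates: lower bounds and averages -/

section EnergySums

variable {𝔽 : Type*} [Field 𝔽] [DecidableEq 𝔽]

/-- A bound for `D H + N H` gives a lower bound for the energy of `H` with its dilate by `N / D`. -/
theorem card_pow_three_le_mul_dilateEnergy {H : Finset 𝔽} (hne : H.Nonempty) (hneg : -H = H)
    {N D ζ : 𝔽} (hD : D ≠ 0) (hND : ζ * D = N) {M : ℝ}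
    (h : CovByVAdd 𝔽 M (N • (H : Set 𝔽) + D • (H : Set 𝔽)) (H : Set 𝔽)) :
    (H.card : ℝ) ^ 3 ≤ M * dilateEnergy H ζ := by
  have hH : (0 : ℝ) < H.card := by exact_mod_cast hne.card_pos
  have h1 := CovByVAdd.card_le (S := N • H + D • H) (by push_cast; exact h)
  -- With ζ = N/D, the values x - ζy lie in D⁻¹(NH + DH), which is small, so Cauchy–Schwarz forces
  -- many collisions.
  have h2 := card_sq_le_card_mul_card_filter_apply_eq (H ×ˢ H)
    (fun p : 𝔽 × 𝔽 => p.1 - ζ * p.2) (u := D⁻¹ • (N • H + D • H)) (by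
      rintro ⟨x, y⟩ hxy
      obtain ⟨hx, hy⟩ := Finset.mem_product.1 hxy
      have hy' : -y ∈ H := by rw [← hneg]; exact Finset.neg_mem_neg hy
      refine Finset.mem_smul_finset.2 ⟨N • (-y) + D • x, Finset.add_mem_add
        (Finset.smul_mem_smul_finset hy') (Finset.smul_mem_smul_finset hx), ?_⟩
      simp only [smul_eq_mul, ← hND]
      field_simp
      ring)
  rw [← dilateEnergy_eq_card, Finset.card_product] at h2
  have h3 : (D⁻¹ • (N • H + D • H)).card = (N • H + D • H).card :=
    Finset.card_smul_finset (Units.mk0 D⁻¹ (inv_ne_zero hD)) _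
  rw [h3] at h2
  have h4 : ((H.card : ℝ) * H.card) ^ 2 ≤ ((N • H + D • H).card : ℝ) * dilateEnergy H ζ := by
    exact_mod_cast h2
  refine le_of_mul_le_mul_left (a := (H.card : ℝ)) ?_ hH
  calc (H.card : ℝ) * (H.card : ℝ) ^ 3 = ((H.card : ℝ) * H.card) ^ 2 := by ring
    _ ≤ ((N • H + D • H).card : ℝ) * dilateEnergy H ζ := h4
    _ ≤ M * H.card * dilateEnergy H ζ := by gcongr
    _ = _ := by ring

/-- An upper bound for the total energy of `B` with its dilates by elements of a subfield `F`, in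
terms of the distribution of `B` in the cosets of an `F`-subspace. -/
theorem sum_dilateEnergy_le {F : Subfield 𝔽} (V : Submodule F 𝔽) [DecidableEq (𝔽 ⧸ V)]
    [DecidablePred (· ∈ V)] {Y : Finset 𝔽}
    (hYF : ∀ y ∈ Y, y ∈ F) (hY0 : (0 : 𝔽) ∉ Y) (B : Finset 𝔽) {p : ℕ}
    (hp : ∀ t ∈ B, (B.filter fun b => t - b ∈ V).card ≤ p) :
    ∑ η ∈ Y, dilateEnergy B η ≤
      Y.card * (B.card * B.card * p) + B.card ^ 3 * (B.image (Submodule.Quotient.mk (p := V))).card := by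
  classical
  have hsplit : ∀ η, dilateEnergy B η =
      (((B ×ˢ B ×ˢ B ×ˢ B).filter fun t => t.1 - t.2.1 = η * (t.2.2.1 - t.2.2.2)).filter
        fun t => t.2.2.1 - t.2.2.2 ∈ V).card +
      (((B ×ˢ B ×ˢ B ×ˢ B).filter fun t => t.1 - t.2.1 = η * (t.2.2.1 - t.2.2.2)).filter
        fun t => ¬ t.2.2.1 - t.2.2.2 ∈ V).card := fun η =>
    (Finset.card_filter_add_card_filter_not _).symm
  rw [Finset.sum_congr rfl fun η _ => hsplit η, Finset.sum_add_distrib]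
  refine add_le_add ?_ ?_
  · rw [← smul_eq_mul, ← Finset.sum_const]
    refine Finset.sum_le_sum fun η _ => ?_
    have h1 : ((B ×ˢ B).sigma fun q => B.filter fun b => q.2 - b ∈ V).card ≤
        B.card * B.card * p := by
      rw [Finset.card_sigma, ← Finset.card_product, ← smul_eq_mul, ← Finset.sum_const]
      exact Finset.sum_le_sum fun q hq => hp q.2 (Finset.mem_product.1 hq).2
    refine le_trans ?_ h1
    -- Solutions with c - d ∈ V: d lies in the coset of c, and b is determined by a, c, d and η.
    refine Finset.card_le_card_of_injOn (fun t => ⟨(t.1, t.2.2.1), t.2.2.2⟩) ?_ ?_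
    · rintro ⟨a, b, c, d⟩ ht
      simp only [Finset.coe_filter, Finset.mem_filter, Finset.mem_product,
        Set.mem_ofPred_eq] at ht
      simp only [Finset.coe_sigma, Set.mem_sigma_iff, Finset.mem_coe, Finset.mem_filter,
        Finset.mem_product]
      tauto
    · rintro ⟨a, b, c, d⟩ ht ⟨a', b', c', d'⟩ ht' h
      simp only [Finset.coe_filter, Finset.mem_filter, Finset.mem_product,
        Set.mem_ofPred_eq] at ht ht'
      simp only [Sigma.mk.injEq, Prod.mk.injEq, heq_eq_eq] at h
      obtain ⟨⟨rfl, rfl⟩, rfl⟩ := h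
      have : b = b' := by linear_combination ht'.1.2 - ht.1.2
      rw [this]
  · rw [← Finset.card_sigma]
    have h1 : (B ×ˢ B ×ˢ B ×ˢ B.image (Submodule.Quotient.mk (p := V))).card =
        B.card ^ 3 * (B.image (Submodule.Quotient.mk (p := V))).card := by
      simp only [Finset.card_product]; ring
    rw [← h1]
    -- Solutions with c - d ∉ V, for all η together: a, b, c and the coset of d determine both η and
    -- d. If η(c - d) = η'(c - d') with d - d' ∈ V, then (η - η')(c - d) = η'(d - d') ∈ V, which
    -- forces η = η'.
    refine Finset.card_le_card_of_injOn
      (fun s => (s.2.1, s.2.2.1, s.2.2.2.1, Submodule.Quotient.mk s.2.2.2.2)) ?_ ?_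
    · rintro ⟨η, a, b, c, d⟩ ht
      simp only [Finset.coe_sigma, Set.mem_sigma_iff, Finset.mem_coe, Finset.mem_filter,
        Finset.mem_product] at ht
      simp only [Finset.coe_product, Set.mem_prod, Finset.mem_coe]
      exact ⟨ht.2.1.1.1, ht.2.1.1.2.1, ht.2.1.1.2.2.1, Finset.mem_image_of_mem _ ht.2.1.1.2.2.2⟩
    · rintro ⟨η, a, b, c, d⟩ ht ⟨η', a', b', c', d'⟩ ht' h
      simp only [Finset.coe_sigma, Set.mem_sigma_iff, Finset.mem_coe, Finset.mem_filter,
        Finset.mem_product] at ht ht'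
      simp only [Prod.mk.injEq] at h
      obtain ⟨rfl, rfl, rfl, h⟩ := h
      rw [Submodule.Quotient.eq] at h
      have e : η * (c - d) = η' * (c - d') := ht.2.1.2.symm.trans ht'.2.1.2
      have hη : η = η' := by
        by_contra hne
        refine ht.2.2 ?_
        have hF := hYF η ht.1
        have hF' := hYF η' ht'.1
        have hm : (⟨(η - η')⁻¹ * η', F.mul_mem (F.inv_mem (F.sub_mem hF hF')) hF'⟩ : F) • (d - d')
            ∈ V := V.smul_mem _ h
        convert hm using 1
        change c - d = (η - η')⁻¹ * η' * (d - d')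
        have hne' : η - η' ≠ 0 := sub_ne_zero.2 hne
        field_simp
        linear_combination e
      subst hη
      have hη0 : η ≠ 0 := fun h0 => hY0 (h0 ▸ ht.1)
      have := mul_left_cancel₀ hη0 e
      have hd : d = d' := by linear_combination -this
      rw [hd]

/-- A set of intermediate size cannot have large energy with all its dilates. -/
theorem exists_mul_dilateEnergy_lt [Fintype 𝔽] {H : Finset 𝔽} (hne : H.Nonempty) {M : ℝ}
    (hM : 0 < M) (h1 : 2 * M ≤ H.card) (h2 : 2 * M * H.card < Fintype.card 𝔽 - 1) :
    ∃ ζ : 𝔽, M * dilateEnergy H ζ < (H.card : ℝ) ^ 3 := by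
  classical
  by_contra! hcon
  have hH : (0 : ℝ) < H.card := by exact_mod_cast hne.card_pos
  -- With V = 0 over the whole field, the cosets are points and the total over nonzero dilates is at
  -- most (q - 1)|H|² + |H|⁴.
  have hs := sum_dilateEnergy_le (F := ⊤) (⊥ : Submodule (⊤ : Subfield 𝔽) 𝔽)
    (Y := Finset.univ.erase 0) (fun _ _ => Subfield.mem_top _) (by simp) H (p := 1) (by
      intro t _
      refine Finset.card_le_one.2 fun a ha b hb => ?_
      simp only [Finset.mem_filter, Submodule.mem_bot] at ha hb
      linear_combination hb.2 - ha.2)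
  have hcardq : ((Finset.univ.erase (0 : 𝔽)).card : ℝ) = Fintype.card 𝔽 - 1 := by
    rw [Finset.card_erase_of_mem (Finset.mem_univ _), Finset.card_univ,
      Nat.cast_sub Fintype.card_pos, Nat.cast_one]
  set Q : ℝ := (Fintype.card 𝔽 : ℝ) - 1 with hQ
  have himg : (H.image (Submodule.Quotient.mk (p := (⊥ : Submodule (⊤ : Subfield 𝔽) 𝔽)))).card ≤
      H.card := Finset.card_image_le
  have hs' : (∑ η ∈ Finset.univ.erase (0 : 𝔽), (dilateEnergy H η : ℝ)) ≤
      Q * (H.card * H.card) + H.card ^ 3 * H.card := by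
    rw [← hcardq]
    have : ∑ η ∈ Finset.univ.erase (0 : 𝔽), dilateEnergy H η ≤
        (Finset.univ.erase (0 : 𝔽)).card * (H.card * H.card) + H.card ^ 3 * H.card := by
      refine hs.trans ?_
      rw [mul_one]
      gcongr
    exact_mod_cast this
  have hlow : Q * (H.card : ℝ) ^ 3 ≤ M * ∑ η ∈ Finset.univ.erase (0 : 𝔽), (dilateEnergy H η : ℝ) := by
    rw [Finset.mul_sum, ← hcardq, ← nsmul_eq_mul, ← Finset.sum_const]
    exact Finset.sum_le_sum fun ζ _ => hcon ζ
  set l : ℝ := (H.card : ℝ) with hl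
  have h3 : Q * l ^ 3 ≤ M * (Q * (l * l) + l ^ 3 * l) := hlow.trans (by gcongr)
  have h4 : l ^ 2 * (Q * l) ≤ l ^ 2 * (M * Q + M * l ^ 2) := by linarith
  have h5 := le_of_mul_le_mul_left h4 (by positivity)
  have hQ0 : 0 ≤ Q := le_trans (by positivity) h2.le
  have h6 : 2 * M * Q ≤ l * Q := by gcongr
  have h7 : l * (2 * M * l) < l * Q := by gcongr
  linarith [h5, h6, h7, show l * (2 * M * l) = 2 * (M * l ^ 2) by ring]

end EnergySums

/-! ### Pivoting: a subfield, or every element is a cheap quotient -/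

section Pivot

variable {𝔽 : Type*} [Field 𝔽]

/-- If the set of quotients of differences of `Y ∋ 1` is stable under translation by `1` and
under multiplication by `Y`, then it contains the subfield generated by `Y`. -/
theorem exists_subfield_of_quotient_stable [Fintype 𝔽] {Y R : Set 𝔽}
    (h0R : (0 : 𝔽) ∈ R) (hRneg : ∀ ρ ∈ R, -ρ ∈ R) (hRinv : ∀ ρ ∈ R, ρ⁻¹ ∈ R)
    (hadd : ∀ ρ ∈ R, ρ + 1 ∈ R) (hmul : ∀ ρ ∈ R, ∀ y ∈ Y, y * ρ ∈ R) (hY0 : (0 : 𝔽) ∉ Y) :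
    ∃ F : Subfield 𝔽, Y ⊆ F ∧ (F : Set 𝔽) ⊆ R := by
  have hdiv : ∀ ρ ∈ R, ∀ y ∈ Y, y⁻¹ * ρ ∈ R := by
    intro ρ hρ y hy
    have := hRinv _ (hmul _ (hRinv ρ hρ) y hy)
    rwa [mul_inv, inv_inv] at this
  have hmon : ∀ m ∈ Submonoid.closure Y, ∀ ρ ∈ R, ρ + m ∈ R := by
    intro m hm
    -- For a product ym, use ρ + ym = y(y⁻¹ρ + m); stability under y⁻¹ is `hdiv`.
    induction hm using Submonoid.closure_induction_left with
    | one => exact hadd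
    | mul_left y hy m _ ih =>
      intro ρ hρ
      have h1 := hmul _ (ih _ (hdiv ρ hρ y hy)) y hy
      have hy0 : y ≠ 0 := fun h => hY0 (h ▸ hy)
      rwa [mul_add, mul_inv_cancel_left₀ hy0] at h1
  have hring : ∀ s ∈ Subring.closure Y, ∀ ρ ∈ R, ρ + s ∈ R := by
    intro s hs
    rw [Subring.mem_closure_iff] at hs
    induction hs using AddSubgroup.closure_induction with
    | mem m hm => exact hmon m hm
    | zero => intro ρ hρ; rwa [add_zero]
    | add a b _ _ iha ihb => intro ρ hρ; rw [← add_assoc]; exact ihb _ (iha _ hρ)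
    | neg a _ iha =>
      intro ρ hρ
      have := hRneg _ (iha _ (hRneg _ hρ))
      rwa [neg_add, neg_neg] at this
  refine ⟨{ Subring.closure Y with inv_mem' := ?_ }, Subring.subset_closure, ?_⟩
  · intro x hx
    by_cases hx0 : x = 0
    · subst hx0; rw [inv_zero]; exact (Subring.closure Y).zero_mem
    · have hq := FiniteField.pow_card_sub_one_eq_one x hx0
      have hq2 : Fintype.card 𝔽 - 1 = (Fintype.card 𝔽 - 2) + 1 := by
        have := Fintype.one_lt_card (α := 𝔽); omega
      rw [hq2, pow_succ] at hq
      rw [inv_eq_of_mul_eq_one_left hq]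
      exact (Subring.closure Y).pow_mem hx _
  · intro s hs
    have := hring s hs 0 h0R
    rwa [zero_add] at this

/-- Either the quotients of differences of `Y` contain the field generated by `Y`, or some quotient
`e / f` of low complexity is not a quotient of differences of `Y`. -/
theorem exists_subfield_or_exists_pivot [Fintype 𝔽] {Y : Finset 𝔽} (h1 : (1 : 𝔽) ∈ Y)
    (hY0 : (0 : 𝔽) ∉ Y) (hY2 : 2 ≤ Y.card) {H : Set 𝔽} (hneg : -H = H) {W W₀ : ℝ} (hW : 1 ≤ W)
    (hW₀ : 1 ≤ W₀) (hH : CovByVAdd 𝔽 W₀ (H + H) H) (hYH : ∀ y ∈ Y, CovByVAdd 𝔽 W (y • H) H) :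
    (∃ F : Subfield 𝔽, (Y : Set 𝔽) ⊆ F ∧ ∀ ζ ∈ F, ∃ a ∈ Y, ∃ b ∈ Y, ∃ c ∈ Y, ∃ d ∈ Y,
      c ≠ d ∧ ζ * (c - d) = a - b) ∨
    ∃ e f : 𝔽, f ≠ 0 ∧ CovByVAdd 𝔽 (W ^ 5 * W₀ ^ 4) (f • H + e • H) H ∧
      ∀ a ∈ Y, ∀ b ∈ Y, ∀ c ∈ Y, ∀ d ∈ Y, e * (c - d) = f * (a - b) → c = d := by
  set R : Set 𝔽 := {ζ | ∃ a ∈ Y, ∃ b ∈ Y, ∃ c ∈ Y, ∃ d ∈ Y, c ≠ d ∧ ζ * (c - d) = a - b} with hR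
  have hsub : ∀ a ∈ Y, ∀ b ∈ Y, CovByVAdd 𝔽 (W * W * W₀) ((a - b) • H) H := fun a ha b hb =>
    (hYH a ha).sub_smul hneg (hYH b hb) hH
  have hW0 : 0 < W := by linarith
  have hW₀0 : 0 < W₀ := by linarith
  by_cases hadd : ∀ ρ ∈ R, ρ + 1 ∈ R
  · by_cases hmul : ∀ ρ ∈ R, ∀ y ∈ (Y : Set 𝔽), y * ρ ∈ R
    · left
      refine exists_subfield_of_quotient_stable (R := R) ?_ ?_ ?_ hadd hmul hY0
      · obtain ⟨c, hc, d, hd, hcd⟩ := Finset.one_lt_card.1 (show 1 < Y.card from hY2)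
        exact ⟨1, h1, 1, h1, c, hc, d, hd, hcd, by ring⟩
      · rintro ρ ⟨a, ha, b, hb, c, hc, d, hd, hcd, h⟩
        exact ⟨b, hb, a, ha, c, hc, d, hd, hcd, by linear_combination -h⟩
      · rintro ρ ⟨a, ha, b, hb, c, hc, d, hd, hcd, h⟩
        by_cases hρ : ρ = 0
        · subst hρ; rw [inv_zero]
          exact ⟨1, h1, 1, h1, c, hc, d, hd, hcd, by ring⟩
        · refine ⟨c, hc, d, hd, a, ha, b, hb, fun hab => ?_, ?_⟩
          · rw [hab, sub_self] at h
            exact (mul_ne_zero hρ (sub_ne_zero.2 hcd)) h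
          · rw [← h, inv_mul_cancel_left₀ hρ]
    · right
      push Not at hmul
      obtain ⟨ρ, ⟨a, ha, b, hb, c, hc, d, hd, hcd, h⟩, y, hy, hyρ⟩ := hmul
      -- The pivot is e/f = yρ, which lies outside R.
      refine ⟨y * (a - b), c - d, sub_ne_zero.2 hcd, ?_, ?_⟩
      · have h2 : CovByVAdd 𝔽 (W * W * W₀ * W) ((y * (a - b)) • H) H := by
          rw [mul_smul]
          exact ((hsub a ha b hb).smul_left y).trans (hYH y hy)
        refine ((hsub c hc d hd).add_of_add h2 hH).mono ?_
        calc W * W * W₀ * (W * W * W₀ * W) * W₀ = W ^ 5 * W₀ ^ 3 := by ring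
          _ ≤ W ^ 5 * W₀ ^ 4 := by
            gcongr; norm_num
      · intro a' ha' b' hb' c' hc' d' hd' h'
        by_contra hne
        refine hyρ ⟨a', ha', b', hb', c', hc', d', hd', hne, ?_⟩
        refine mul_left_cancel₀ (sub_ne_zero.2 hcd) ?_
        linear_combination h' + y * (c' - d') * h
  · right
    push Not at hadd
    obtain ⟨ρ, ⟨a, ha, b, hb, c, hc, d, hd, hcd, h⟩, hρ⟩ := hadd
    -- The pivot is e/f = ρ + 1, which lies outside R.
    refine ⟨(c - d) + (a - b), c - d, sub_ne_zero.2 hcd, ?_, ?_⟩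
    · have h2 : CovByVAdd 𝔽 W₀ ((c - d) • H + (c - d) • H) ((c - d) • H) := by
        rw [← smul_add]; exact hH.smul_left _
      have h3 := ((h2.trans (hsub c hc d hd)).add_of_add (hsub a ha b hb) hH)
      refine (h3.mono ?_).subset_left ?_
      · calc W₀ * (W * W * W₀) * (W * W * W₀) * W₀ = W ^ 4 * W₀ ^ 4 := by ring
          _ ≤ W ^ 5 * W₀ ^ 4 := by
            gcongr; norm_num
      · rw [add_assoc]
        exact Set.add_subset_add_left (Set.add_smul_subset _ _ _)
    · intro a' ha' b' hb' c' hc' d' hd' h'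
      by_contra hne
      refine hρ ⟨a', ha', b', hb', c', hc', d', hd', hne, ?_⟩
      refine mul_left_cancel₀ (sub_ne_zero.2 hcd) ?_
      linear_combination h' + (c' - d') * h

/-- Given a pivot for a set `Y` with more than `|𝔽|^{1/4}` elements, every element of `𝔽` is a
quotient of low complexity. -/
theorem exists_covByVAdd_of_pivot [Fintype 𝔽] [DecidableEq 𝔽] {Y : Finset 𝔽}
    (hYcard : Fintype.card 𝔽 < Y.card ^ 4) {H : Set 𝔽} (hneg : -H = H) {W W₀ E : ℝ}
    (hH : CovByVAdd 𝔽 W₀ (H + H) H) (hYH : ∀ y ∈ Y, CovByVAdd 𝔽 W (y • H) H)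
    {e f : 𝔽} (hf : f ≠ 0) (hef : CovByVAdd 𝔽 E (f • H + e • H) H)
    (hpivot : ∀ a ∈ Y, ∀ b ∈ Y, ∀ c ∈ Y, ∀ d ∈ Y, e * (c - d) = f * (a - b) → c = d) (ζ : 𝔽) :
    ∃ N D : 𝔽, D ≠ 0 ∧ ζ * D = N ∧
      CovByVAdd 𝔽 (W ^ 8 * W₀ ^ 6 * E) (N • H + D • H) H := by
  have hsub : ∀ a ∈ Y, ∀ b ∈ Y, CovByVAdd 𝔽 (W * W * W₀) ((a - b) • H) H := fun a ha b hb =>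
    (hYH a ha).sub_smul hneg (hYH b hb) hH
  have hinj : ∀ a ∈ Y, ∀ b ∈ Y, ∀ c ∈ Y, ∀ d ∈ Y, f * (a - b) + e * (c - d) = 0 →
      a = b ∧ c = d := by
    intro a ha b hb c hc d hd h
    have h1 : c = d := hpivot b hb a ha c hc d hd (by linear_combination h)
    rw [h1, sub_self, mul_zero, add_zero] at h
    exact ⟨sub_eq_zero.1 ((mul_eq_zero.1 h).resolve_left hf), h1⟩
  -- Since |Y|⁴ > q, two quadruples collide, which expresses ζ as a quotient. Its denominator is
  -- nonzero: otherwise `hinj`, applied to denominator and numerator in turn, would make the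
  -- quadruples equal.
  obtain ⟨⟨a, b, c, d⟩, hx, ⟨a', b', c', d'⟩, hx', hne, heq⟩ :=
    Finset.exists_ne_map_eq_of_card_lt_of_maps_to (s := Y ×ˢ Y ×ˢ Y ×ˢ Y)
      (t := (Finset.univ : Finset 𝔽))
      (f := fun s => f * s.1 + e * s.2.1 - ζ * (f * s.2.2.1 + e * s.2.2.2))
      (by
        simp only [Finset.card_product, Finset.card_univ]
        calc _ < Y.card ^ 4 := hYcard
          _ = _ := by ring) (fun _ _ => Finset.mem_univ _)
  simp only [Finset.mem_product] at hx hx'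
  obtain ⟨ha, hb, hc, hd⟩ := hx
  obtain ⟨ha', hb', hc', hd'⟩ := hx'
  have hND : ζ * (f * (c - c') + e * (d - d')) = f * (a - a') + e * (b - b') := by
    simp only at heq
    linear_combination -heq
  refine ⟨f * (a - a') + e * (b - b'), f * (c - c') + e * (d - d'), fun hD => hne ?_, hND, ?_⟩
  · rw [hD, mul_zero] at hND
    obtain ⟨rfl, rfl⟩ := hinj c hc c' hc' d hd d' hd' hD
    obtain ⟨rfl, rfl⟩ := hinj a ha a' ha' b hb b' hb' hND.symm
    rfl
  · have hS₁ := ((hsub a ha a' ha').add_of_add (hsub c hc c' hc') hH).smul_left f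
    have hS₂ := ((hsub b hb b' hb').add_of_add (hsub d hd d' hd') hH).smul_left e
    refine (((hS₁.add hS₂).trans hef).mono (le_of_eq (by ring))).subset_left ?_
    refine (Set.add_subset_add (Set.add_smul_subset _ _ _) (Set.add_smul_subset _ _ _)).trans ?_
    rw [add_add_add_comm, smul_add, smul_add]
    simp only [mul_smul, subset_refl]

/-- A set `H` of intermediate size which is an approximate group and approximately stable under
multiplication by the elements of a large set `Y` has large energy with its dilates by all the
elements of a subfield containing `Y`. -/
theorem exists_subfield_dilateEnergy_ge [Fintype 𝔽] [DecidableEq 𝔽] {Y : Finset 𝔽}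
    (h1 : (1 : 𝔽) ∈ Y) (hY0 : (0 : 𝔽) ∉ Y) (hY2 : 2 ≤ Y.card)
    (hYcard : Fintype.card 𝔽 < Y.card ^ 4) {H : Finset 𝔽} (hne : H.Nonempty) (hneg : -H = H)
    {W W₀ : ℝ} (hW : 1 ≤ W) (hW₀ : 1 ≤ W₀)
    (hH : CovByVAdd 𝔽 W₀ ((H : Set 𝔽) + (H : Set 𝔽)) (H : Set 𝔽))
    (hYH : ∀ y ∈ Y, CovByVAdd 𝔽 W (y • (H : Set 𝔽)) (H : Set 𝔽))
    (hsmall : 2 * (W ^ 13 * W₀ ^ 10) ≤ H.card)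
    (hlarge : 2 * (W ^ 13 * W₀ ^ 10) * H.card < Fintype.card 𝔽 - 1) :
    ∃ F : Subfield 𝔽, (Y : Set 𝔽) ⊆ F ∧
      ∀ ζ ∈ F, (H.card : ℝ) ^ 3 ≤ W ^ 4 * W₀ ^ 3 * dilateEnergy H ζ := by
  have hneg' : -(H : Set 𝔽) = H := by rw [← Finset.coe_neg, hneg]
  have hW0 : 0 < W := by linarith
  have hW₀0 : 0 < W₀ := by linarith
  rcases exists_subfield_or_exists_pivot h1 hY0 hY2 hneg' hW hW₀ hH hYH with
    ⟨F, hYF, hF⟩ | ⟨e, f, hf, hef, hpivot⟩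
  · refine ⟨F, hYF, fun ζ hζ => ?_⟩
    obtain ⟨a, ha, b, hb, c, hc, d, hd, hcd, h⟩ := hF ζ hζ
    refine card_pow_three_le_mul_dilateEnergy hne hneg (sub_ne_zero.2 hcd) h ?_
    refine (((hYH a ha).sub_smul hneg' (hYH b hb) hH).add_of_add
      ((hYH c hc).sub_smul hneg' (hYH d hd) hH) hH).mono (le_of_eq (by ring))
  -- A pivot would give every ζ an energy at least |H|³/(W¹³W₀¹⁰), against the average.
  · exfalso
    obtain ⟨ζ, hζ⟩ := exists_mul_dilateEnergy_lt hne (M := W ^ 13 * W₀ ^ 10) (by positivity)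
      hsmall hlarge
    obtain ⟨N, D, hD, hND, hcov⟩ := exists_covByVAdd_of_pivot hYcard hneg' hH hYH hf hef hpivot ζ
    have := card_pow_three_le_mul_dilateEnergy hne hneg hD hND
      (hcov.mono (le_of_eq (by ring : _ = W ^ 13 * W₀ ^ 10)))
    linarith

end Pivot

/-! ### Hyperplanes over a subfield from additive characters -/

section Annihilator

variable {𝔽 : Type*} [Field 𝔽]

/-- The largest `F`-subspace contained in the kernel of an additive character. -/
def AddChar.subspaceKer (F : Subfield 𝔽) (χ : AddChar 𝔽 ℂ) : Submodule F 𝔽 where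
  carrier := {v | ∀ ζ : F, χ ((ζ : 𝔽) * v) = 1}
  zero_mem' ζ := by rw [mul_zero, AddChar.map_zero_eq_one]
  add_mem' {v w} hv hw ζ := by rw [mul_add, AddChar.map_add_eq_mul, hv ζ, hw ζ, one_mul]
  smul_mem' c v hv ζ := by
    have := hv (ζ * c)
    rwa [Subfield.coe_mul, mul_assoc] at this

theorem AddChar.mem_subspaceKer {F : Subfield 𝔽} {χ : AddChar 𝔽 ℂ} {v : 𝔽} :
    v ∈ χ.subspaceKer F ↔ ∀ ζ : F, χ ((ζ : 𝔽) * v) = 1 := Iff.rfl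

open Classical in
theorem AddChar.sum_subfield_neg_mul {F : Subfield 𝔽} [Fintype F] (χ : AddChar 𝔽 ℂ) (v : 𝔽) :
    ∑ ζ : F, χ (-((ζ : 𝔽) * v)) = if v ∈ χ.subspaceKer F then (Fintype.card F : ℂ) else 0 := by
  set φ : AddChar F ℂ :=
    χ.compAddMonoidHom (-((AddMonoidHom.mulRight v).comp F.subtype.toAddMonoidHom)) with hφ
  have h1 : ∀ ζ : F, φ ζ = χ (-((ζ : 𝔽) * v)) := fun ζ => rfl
  simp only [← h1]
  rw [AddChar.sum_eq_ite]
  have h2 : φ = 0 ↔ v ∈ χ.subspaceKer F := by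
    rw [AddChar.mem_subspaceKer, AddChar.eq_zero_iff]
    constructor
    · intro h ζ
      have := h (-ζ)
      rwa [h1, Subfield.coe_neg, neg_mul, neg_neg] at this
    · intro h ζ
      have := h (-ζ)
      rwa [Subfield.coe_neg, neg_mul, ← h1] at this
  simp only [h2]

/-- Double counting of χ(-ζv) over v ∈ 𝔽 and ζ ∈ F: summing over ζ first gives |F| times the size of
the kernel, summing over v first leaves only ζ = 0. So the kernel is a hyperplane. -/
theorem AddChar.card_subspaceKer_mul_card [Fintype 𝔽] (F : Subfield 𝔽) {χ : AddChar 𝔽 ℂ}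
    (hχ : χ ≠ 0) : Nat.card (χ.subspaceKer F) * Nat.card F = Fintype.card 𝔽 := by
  classical
  have hF : Fintype F := Fintype.ofFinite F
  have h1 : ∑ v : 𝔽, ∑ ζ : F, χ (-((ζ : 𝔽) * v)) = Nat.card (χ.subspaceKer F) * Fintype.card F := by
    simp only [AddChar.sum_subfield_neg_mul]
    rw [← Finset.sum_filter, Finset.sum_const, nsmul_eq_mul]
    congr 2
    rw [Nat.card_eq_fintype_card, Fintype.card_subtype]
  have h2 : ∑ v : 𝔽, ∑ ζ : F, χ (-((ζ : 𝔽) * v)) = Fintype.card 𝔽 := by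
    rw [Finset.sum_comm]
    rw [Finset.sum_eq_single 0]
    · simp
    · intro ζ _ hζ
      have h3 : ∀ v, χ (-((ζ : 𝔽) * v)) = AddChar.mulShift χ (-(ζ : 𝔽)) v := by
        intro v; rw [AddChar.mulShift_apply, neg_mul]
      simp only [h3]
      rw [AddChar.sum_eq_zero_iff_ne_zero]
      intro h
      refine hχ ?_
      rw [AddChar.eq_zero_iff] at h ⊢
      intro x
      have hζ' : (ζ : 𝔽) ≠ 0 := fun h0 => hζ (Subtype.ext h0)
      have := h ((-(ζ : 𝔽))⁻¹ * x)
      rwa [AddChar.mulShift_apply, mul_inv_cancel_left₀ (neg_ne_zero.2 hζ')] at this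
    · simp
  rw [h1] at h2
  rw [Nat.card_eq_fintype_card (α := F)]
  exact_mod_cast h2

end Annihilator

/-! ### Fourier analysis of the energies over a subfield -/

section Fourier

variable {𝔽 : Type*} [Field 𝔽]

/-- The squared absolute value of the Fourier coefficient of the indicator function of `H`. -/
noncomputable def fourierSq (H : Finset 𝔽) (χ : AddChar 𝔽 ℂ) : ℝ :=
  Complex.normSq (∑ h ∈ H, χ h)

theorem fourierSq_nonneg (H : Finset 𝔽) (χ : AddChar 𝔽 ℂ) : 0 ≤ fourierSq H χ :=
  Complex.normSq_nonneg _

theorem ofReal_fourierSq [Finite 𝔽] (H : Finset 𝔽) (χ : AddChar 𝔽 ℂ) :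
    (fourierSq H χ : ℂ) = ∑ p ∈ H ×ˢ H, χ (p.1 - p.2) := by
  rw [fourierSq, ← Complex.mul_conj, map_sum, Finset.sum_mul_sum, Finset.sum_product]
  refine Finset.sum_congr rfl fun a _ => Finset.sum_congr rfl fun b _ => ?_
  rw [sub_eq_add_neg, AddChar.map_add_eq_mul, AddChar.map_neg_eq_conj]

theorem fourierSq_zero (H : Finset 𝔽) : fourierSq H 0 = (H.card : ℝ) ^ 2 := by
  simp [fourierSq, sq]

variable [Fintype 𝔽] [DecidableEq 𝔽]

theorem sum_fourierSq (H : Finset 𝔽) :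
    ∑ χ : AddChar 𝔽 ℂ, fourierSq H χ = Fintype.card 𝔽 * H.card := by
  have h : ∑ χ : AddChar 𝔽 ℂ, (fourierSq H χ : ℂ) = Fintype.card 𝔽 * H.card := by
    simp only [ofReal_fourierSq]
    rw [Finset.sum_comm]
    simp only [AddChar.sum_apply_eq_ite, sub_eq_zero]
    rw [Finset.sum_product]
    simp [mul_comm]
  exact_mod_cast h

/-- Orthogonality of characters detects p₁ - p₂ = ζ(r₁ - r₂). The dependence on ζ sits in one
character value, ready to be summed over a subfield. -/
theorem card_mul_dilateEnergy (H : Finset 𝔽) (ζ : 𝔽) :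
    (Fintype.card 𝔽 * dilateEnergy H ζ : ℂ) =
      ∑ χ : AddChar 𝔽 ℂ, ∑ r ∈ H ×ˢ H, fourierSq H χ * χ (-(ζ * (r.1 - r.2))) := by
  simp only [ofReal_fourierSq, Finset.sum_mul]
  rw [Finset.sum_comm]
  have h : ∀ r : 𝔽 × 𝔽, ∑ χ : AddChar 𝔽 ℂ, ∑ p ∈ H ×ˢ H, χ (p.1 - p.2) * χ (-(ζ * (r.1 - r.2))) =
      ∑ p ∈ H ×ˢ H, if p.1 - p.2 = ζ * (r.1 - r.2) then (Fintype.card 𝔽 : ℂ) else 0 := by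
    intro r
    rw [Finset.sum_comm]
    refine Finset.sum_congr rfl fun p _ => ?_
    simp only [← AddChar.map_add_eq_mul, ← sub_eq_add_neg, AddChar.sum_apply_eq_ite, sub_eq_zero]
  simp only [h]
  rw [dilateEnergy, Finset.card_filter, Finset.sum_comm]
  simp only [Finset.sum_product]
  push_cast
  simp only [Finset.mul_sum, mul_ite, mul_one, mul_zero]

open Classical in
/-- The total energy of `H` with its dilates by a subfield, in terms of the distribution of `H` in
the cosets of the `F`-hyperplanes. -/
theorem card_mul_sum_dilateEnergy (F : Subfield 𝔽) [Fintype F] (H : Finset 𝔽) :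
    (Fintype.card 𝔽 : ℝ) * ∑ ζ : F, (dilateEnergy H ζ : ℝ) = ∑ χ : AddChar 𝔽 ℂ, fourierSq H χ *
      (Fintype.card F * ((H ×ˢ H).filter fun r => r.1 - r.2 ∈ χ.subspaceKer F).card) := by
  have h : (Fintype.card 𝔽 : ℂ) * ∑ ζ : F, (dilateEnergy H ζ : ℂ) =
      ∑ χ : AddChar 𝔽 ℂ, (fourierSq H χ : ℂ) *
      (Fintype.card F * ((H ×ˢ H).filter fun r => r.1 - r.2 ∈ χ.subspaceKer F).card) := by
    rw [Finset.mul_sum]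
    simp only [card_mul_dilateEnergy]
    rw [Finset.sum_comm]
    refine Finset.sum_congr rfl fun χ _ => ?_
    rw [Finset.sum_comm]
    simp only [← Finset.mul_sum, AddChar.sum_subfield_neg_mul]
    rw [← Finset.sum_filter, Finset.sum_const, nsmul_eq_mul, mul_comm (Fintype.card F : ℂ)]
  exact_mod_cast h

/-- A set with large energy with all its dilates by a subfield `F` has a large intersection with a
translate of an `F`-hyperplane. -/
theorem exists_hyperplane_large_inter (F : Subfield 𝔽) {H : Finset 𝔽} (hne : H.Nonempty) {M : ℝ}
    (hM : 0 < M) (hE : ∀ ζ ∈ F, (H.card : ℝ) ^ 3 ≤ M * dilateEnergy H ζ)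
    (hcard : 2 * M * H.card ≤ Fintype.card 𝔽) :
    ∃ V : Submodule F 𝔽, Nat.card V * Nat.card F = Fintype.card 𝔽 ∧
      ∃ T ⊆ H, (∀ a ∈ T, ∀ b ∈ T, a - b ∈ V) ∧ (H.card : ℝ) ≤ 2 * M * T.card := by
  classical
  have hF : Fintype F := Fintype.ofFinite F
  have hH : (0 : ℝ) < H.card := by exact_mod_cast hne.card_pos
  have hq : (0 : ℝ) < Fintype.card 𝔽 := by exact_mod_cast Fintype.card_pos
  have hf : (0 : ℝ) < Fintype.card F := by exact_mod_cast Fintype.card_pos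
  set c : AddChar 𝔽 ℂ → ℝ := fun χ =>
    (((H ×ˢ H).filter fun r => r.1 - r.2 ∈ χ.subspaceKer F).card : ℝ) with hc
  -- If every nontrivial χ had c(χ) < |H|²/(2M), Parseval would bound their contribution by half of
  -- what the energy requires, and 2M|H| ≤ q bounds that of the trivial character by the other half.
  -- The |H|² subtracted in Parseval makes the contradiction strict.
  obtain ⟨χ, hχ, hχc⟩ : ∃ χ : AddChar 𝔽 ℂ, χ ≠ 0 ∧ (H.card : ℝ) ^ 2 ≤ 2 * M * c χ := by
    by_contra! hcon
    have h1 : (Fintype.card 𝔽 : ℝ) * (Fintype.card F * (H.card : ℝ) ^ 3) ≤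
        M * (Fintype.card 𝔽 * ∑ ζ : F, (dilateEnergy H ζ : ℝ)) := by
      have : (Fintype.card F : ℝ) * (H.card : ℝ) ^ 3 ≤ M * ∑ ζ : F, (dilateEnergy H ζ : ℝ) := by
        rw [Finset.mul_sum, ← nsmul_eq_mul, ← Finset.card_univ, ← Finset.sum_const]
        exact Finset.sum_le_sum fun ζ _ => hE ζ ζ.2
      calc _ ≤ (Fintype.card 𝔽 : ℝ) * (M * ∑ ζ : F, (dilateEnergy H ζ : ℝ)) := by gcongr
        _ = _ := by ring
    rw [card_mul_sum_dilateEnergy] at h1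
    have h2 : ∑ χ : AddChar 𝔽 ℂ, fourierSq H χ * (Fintype.card F * c χ) =
        Fintype.card F * ∑ χ : AddChar 𝔽 ℂ, fourierSq H χ * c χ := by
      rw [Finset.mul_sum]
      exact Finset.sum_congr rfl fun χ _ => by ring
    rw [h2, ← Finset.add_sum_erase _ _ (Finset.mem_univ (0 : AddChar 𝔽 ℂ)), fourierSq_zero] at h1
    have h3 : c 0 ≤ (H.card : ℝ) ^ 2 := by
      simp only [hc, sq]
      exact_mod_cast (Finset.card_filter_le _ _).trans (Finset.card_product H H).le
    have h4 : 2 * M * ∑ χ ∈ Finset.univ.erase (0 : AddChar 𝔽 ℂ), fourierSq H χ * c χ ≤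
        (Fintype.card 𝔽 * H.card - (H.card : ℝ) ^ 2) * (H.card : ℝ) ^ 2 := by
      rw [← sum_fourierSq, ← Finset.add_sum_erase _ _ (Finset.mem_univ (0 : AddChar 𝔽 ℂ)),
        fourierSq_zero, add_sub_cancel_left, Finset.mul_sum, Finset.sum_mul]
      refine Finset.sum_le_sum fun χ hχ => ?_
      have := (hcon χ (Finset.ne_of_mem_erase hχ)).le
      have h5 := mul_le_mul_of_nonneg_left this (fourierSq_nonneg H χ)
      linarith
    set S := ∑ χ ∈ Finset.univ.erase (0 : AddChar 𝔽 ℂ), fourierSq H χ * c χ with hS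
    set l : ℝ := (H.card : ℝ) with hl
    set Q : ℝ := (Fintype.card 𝔽 : ℝ) with hQ
    have h6 : (Fintype.card F : ℝ) * (Q * l ^ 3) ≤ Fintype.card F * (M * (l ^ 2 * c 0 + S)) := by
      linarith
    have h7 := le_of_mul_le_mul_left h6 hf
    have h8 : M * (l ^ 2 * c 0) ≤ M * (l ^ 2 * l ^ 2) := by gcongr
    have h9 : 2 * M * l * l ^ 3 ≤ Q * l ^ 3 := by gcongr
    have h10 : 0 < l ^ 4 := by positivity
    linarith [show (Q * l - l ^ 2) * l ^ 2 = Q * l ^ 3 - l ^ 4 by ring,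
      show M * (l ^ 2 * l ^ 2) = M * l ^ 4 by ring, show 2 * M * l * l ^ 3 = 2 * (M * l ^ 4) by ring]
  refine ⟨χ.subspaceKer F, AddChar.card_subspaceKer_mul_card F hχ, ?_⟩
  have hcsum : c χ = ∑ b ∈ H, ((H.filter fun a => a - b ∈ χ.subspaceKer F).card : ℝ) := by
    simp only [hc, Finset.card_filter, Nat.cast_sum]
    rw [Finset.sum_product_right]
  obtain ⟨b, hb, hbc⟩ : ∃ b ∈ H, (H.card : ℝ) ≤
      2 * M * ((H.filter fun a => a - b ∈ χ.subspaceKer F).card : ℝ) := by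
    refine Finset.exists_le_of_sum_le hne ?_
    rw [← Finset.mul_sum, ← hcsum, Finset.sum_const, nsmul_eq_mul, ← sq]
    exact hχc
  refine ⟨H.filter fun a => a - b ∈ χ.subspaceKer F, Finset.filter_subset _ _, ?_, hbc⟩
  intro x hx y hy
  have := (χ.subspaceKer F).sub_mem (Finset.mem_filter.1 hx).2 (Finset.mem_filter.1 hy).2
  rwa [sub_sub_sub_cancel_right] at this

end Fourier

/-! ### Concentration on a coset, the degree of the subfield, and the theorem -/

section Main

variable {𝔽 : Type*} [Field 𝔽] [DecidableEq 𝔽]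

theorem dilateEnergy_le_card_pow_three (A : Finset 𝔽) (ξ : 𝔽) :
    dilateEnergy A ξ ≤ A.card ^ 3 := by
  have h : (A ×ˢ A ×ˢ A).card = A.card ^ 3 := by
    simp only [Finset.card_product]; ring
  rw [← h]
  refine Finset.card_le_card_of_injOn (fun t => (t.1, t.2.2.1, t.2.2.2)) ?_ ?_
  · rintro ⟨a, b, c, d⟩ ht
    simp only [Finset.coe_filter, Finset.mem_product, Set.mem_ofPred_eq] at ht
    simp only [Finset.coe_product, Set.mem_prod, Finset.mem_coe]
    tauto
  · rintro ⟨a, b, c, d⟩ ht ⟨a', b', c', d'⟩ ht' h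
    simp only [Finset.coe_filter, Finset.mem_product, Set.mem_ofPred_eq] at ht ht'
    simp only [Prod.mk.injEq] at h
    obtain ⟨rfl, rfl, rfl⟩ := h
    have : b = b' := by linear_combination ht'.2 - ht.2
    rw [this]

theorem card_pow_three_le_mul_dilateEnergy_of_card_sub_le {B : Finset 𝔽} {η : 𝔽} {M : ℝ}
    (h : ((η • B - B).card : ℝ) ≤ M * B.card) (hB : B.Nonempty) :
    (B.card : ℝ) ^ 3 ≤ M * dilateEnergy B η := by
  have hBpos : (0 : ℝ) < B.card := by exact_mod_cast hB.card_pos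
  have h2 := card_sq_le_card_mul_card_filter_apply_eq (B ×ˢ B)
    (fun p : 𝔽 × 𝔽 => p.1 - η * p.2) (u := B - η • B) (by
      rintro ⟨x, y⟩ hxy
      obtain ⟨hx, hy⟩ := Finset.mem_product.1 hxy
      exact Finset.sub_mem_sub hx (Finset.smul_mem_smul_finset hy))
  rw [← dilateEnergy_eq_card, Finset.card_product, ← Finset.card_neg (B - η • B), neg_sub] at h2
  have h4 : ((B.card : ℝ) * B.card) ^ 2 ≤ ((η • B - B).card : ℝ) * dilateEnergy B η := by
    exact_mod_cast h2
  refine le_of_mul_le_mul_left (a := (B.card : ℝ)) ?_ hBpos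
  calc (B.card : ℝ) * (B.card : ℝ) ^ 3 = ((B.card : ℝ) * B.card) ^ 2 := by ring
    _ ≤ ((η • B - B).card : ℝ) * dilateEnergy B η := h4
    _ ≤ M * B.card * dilateEnergy B η := by gcongr
    _ = _ := by ring

/-- The number of cosets of `V` met by `B`, times the size of a subset of a coset of `V`, is at most
the size of the sumset. -/
theorem card_image_mk_mul_card_le {R : Type*} [Ring R] [Module R 𝔽] (V : Submodule R 𝔽)
    [DecidableEq (𝔽 ⧸ V)] (B : Finset 𝔽) {T : Finset 𝔽} (hT : ∀ a ∈ T, ∀ b ∈ T, a - b ∈ V) :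
    (B.image (Submodule.Quotient.mk (p := V))).card * T.card ≤ (B + T).card := by
  have h : ∀ c ∈ B.image (Submodule.Quotient.mk (p := V)), ∃ b ∈ B, Submodule.Quotient.mk b = c :=
    fun c hc => Finset.mem_image.1 hc
  choose! g hgB hg using h
  rw [← Finset.card_product]
  refine Finset.card_le_card_of_injOn (fun s => g s.1 + s.2) ?_ ?_
  · rintro ⟨c, t⟩ hs
    obtain ⟨hc, ht⟩ := Finset.mem_product.1 (Finset.mem_coe.1 hs)
    exact Finset.add_mem_add (hgB c hc) ht
  · rintro ⟨c, t⟩ hs ⟨c', t'⟩ hs' heq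
    obtain ⟨hc, ht⟩ := Finset.mem_product.1 (Finset.mem_coe.1 hs)
    obtain ⟨hc', ht'⟩ := Finset.mem_product.1 (Finset.mem_coe.1 hs')
    simp only at heq hc ht hc' ht'
    have hcc : c = c' := by
      rw [← hg c hc, ← hg c' hc', Submodule.Quotient.eq]
      convert hT t' ht' t ht using 1
      linear_combination heq
    subst hcc
    rw [add_left_cancel heq]

/-- A set with small doubling, approximately stable under the dilations in a large set `Y`, has a
large intersection with a coset of a hyperplane over a subfield containing `Y`. -/
theorem exists_subfield_hyperplane_of_card_smul_sub_le [Fintype 𝔽] {B Y : Finset 𝔽} {κ n : ℝ}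
    (hκ : 4 ≤ κ) (h1 : (1 : 𝔽) ∈ Y) (hY0 : (0 : 𝔽) ∉ Y)
    (hYcard : Fintype.card 𝔽 < Y.card ^ 4) (hYκ : κ ^ 400 ≤ Y.card)
    (hnB : n ≤ κ * B.card) (hBB : ((B - B).card : ℝ) ≤ κ ^ 7 * n)
    (hηB : ∀ η ∈ Y, ((η • B - B).card : ℝ) ≤ 2 * κ ^ 18 * B.card)
    (h3B : ((B - B + (B - B) - B).card : ℝ) ≤ κ ^ 20 * B.card)
    (hn : κ ^ 1000 ≤ n) (hnq : κ ^ 950 * n ≤ Fintype.card 𝔽) :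
    ∃ F : Subfield 𝔽, (Y : Set 𝔽) ⊆ F ∧ ∃ V : Submodule F 𝔽,
      Nat.card V * Nat.card F = Fintype.card 𝔽 ∧
      ∃ t ∈ B, ∃ P ⊆ B, (∀ b ∈ P, t - b ∈ V) ∧ (B.card : ℝ) ≤ κ ^ 20 * P.card := by
  classical
  have hκ0 : 0 < κ := by linarith
  have hκ1 : 1 ≤ κ := by linarith
  have hn0 : 0 < n := lt_of_lt_of_le (by positivity) hn
  have hBpos : (0 : ℝ) < B.card := by
    by_contra h
    have : κ * (B.card : ℝ) ≤ 0 := mul_nonpos_of_nonneg_of_nonpos hκ0.le (not_lt.1 h)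
    linarith
  have hBne : B.Nonempty := Finset.card_pos.1 (by exact_mod_cast hBpos)
  set H := B - B with hH
  have hHne : H.Nonempty := hBne.sub hBne
  have hneg : -H = H := neg_sub B B
  have hneg' : -(H : Set 𝔽) = H := by rw [← Finset.coe_neg, hneg]
  have hBH : (B.card : ℝ) ≤ H.card := by
    exact_mod_cast Finset.card_le_card_sub_right hBne
  have hHH : CovByVAdd 𝔽 (κ ^ 20) ((H : Set 𝔽) + (H : Set 𝔽)) (H : Set 𝔽) := by
    rw [← Finset.coe_add]
    exact covByVAdd_sub_of_card_sub_le hBne h3B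
  have hYH : ∀ y ∈ Y, CovByVAdd 𝔽 (κ ^ 57) (y • (H : Set 𝔽)) (H : Set 𝔽) := by
    intro y hy
    have h2 : CovByVAdd 𝔽 (2 * κ ^ 18) ((y • B : Finset 𝔽) : Set 𝔽) (H : Set 𝔽) :=
      covByVAdd_sub_of_card_sub_le hBne (hηB y hy)
    have h3 : CovByVAdd 𝔽 (2 * κ ^ 18) (-((y • B : Finset 𝔽) : Set 𝔽)) (H : Set 𝔽) := by
      obtain ⟨T, hT, hST⟩ := h2
      refine ⟨-T, by rwa [Finset.card_neg], ?_⟩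
      rw [vadd_eq_add] at hST ⊢
      rw [Finset.coe_neg, ← hneg', ← neg_add]
      exact Set.neg_subset_neg.2 hST
    refine ((h2.add_of_add h3 hHH).mono ?_).subset_left ?_
    · calc 2 * κ ^ 18 * (2 * κ ^ 18) * κ ^ 20 = 4 * κ ^ 56 := by ring
        _ ≤ κ * κ ^ 56 := by gcongr
        _ = κ ^ 57 := by ring
    · rw [hH]
      push_cast
      rw [sub_eq_add_neg, smul_add, Set.smul_set_neg]
  have hHn : (H.card : ℝ) ≤ κ ^ 7 * n := hBB
  -- The pivot argument is run with W = κ⁵⁷ and W₀ = κ²⁰; 941 is its total cost, and 288 the cost of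
  -- an element of F.
  have e1 : (κ ^ 57) ^ 13 * (κ ^ 20) ^ 10 = κ ^ 941 := by ring
  have e2 : (κ ^ 57) ^ 4 * (κ ^ 20) ^ 3 = κ ^ 288 := by ring
  have hY2 : 2 ≤ Y.card := by
    have : (2 : ℝ) ≤ Y.card := by
      have : κ ^ 1 ≤ κ ^ 400 := pow_le_pow_right₀ hκ1 (by norm_num)
      linarith [pow_one κ]
    exact_mod_cast this
  have hHsmall : 2 * κ ^ 941 ≤ (H.card : ℝ) := by
    have h2 : κ ^ 1000 ≤ κ * H.card := hn.trans (hnB.trans (by gcongr))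
    refine le_of_mul_le_mul_left (a := κ) (le_trans ?_ h2) hκ0
    calc κ * (2 * κ ^ 941) ≤ κ * (κ * κ ^ 941) := by gcongr; linarith
      _ = κ ^ 943 := by ring
      _ ≤ κ ^ 1000 := pow_le_pow_right₀ hκ1 (by norm_num)
  have hHlarge : 2 * κ ^ 941 * (H.card : ℝ) < Fintype.card 𝔽 - 1 := by
    have h2 : 2 * κ ^ 941 * (H.card : ℝ) ≤ κ ^ 949 * n := by
      calc 2 * κ ^ 941 * (H.card : ℝ) ≤ κ * κ ^ 941 * (κ ^ 7 * n) := by gcongr; linarith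
        _ = κ ^ 949 * n := by ring
    have h3 : 1 ≤ κ ^ 949 * n := one_le_mul_of_one_le_of_one_le (one_le_pow₀ hκ1)
      ((one_le_pow₀ hκ1).trans hn)
    have h4 : κ ^ 950 * n = κ * (κ ^ 949 * n) := by ring
    nlinarith
  obtain ⟨F, hYF, hF⟩ := exists_subfield_dilateEnergy_ge h1 hY0 hY2 hYcard hHne hneg
    (one_le_pow₀ hκ1) (one_le_pow₀ hκ1) hHH hYH (by rw [e1]; exact hHsmall)
    (by rw [e1]; exact hHlarge)
  rw [e2] at hF
  obtain ⟨V, hVF, T, hTH, hTV, hT⟩ := exists_hyperplane_large_inter F hHne (M := κ ^ 288)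
    (by positivity) hF (by
      have : 2 * κ ^ 288 * (H.card : ℝ) ≤ 2 * κ ^ 941 * H.card := by
        gcongr; norm_num
      linarith)
  have hTpos : (0 : ℝ) < T.card := by
    by_contra h
    have h2 : (T.card : ℝ) = 0 := le_antisymm (not_lt.1 h) (Nat.cast_nonneg _)
    rw [h2, mul_zero] at hT
    linarith
  set N := (B.image (Submodule.Quotient.mk (p := V))).card with hN
  -- The translates of T based at distinct cosets of V are disjoint inside B + H, which is covered
  -- by few translates of H.
  have hNκ : (N : ℝ) ≤ κ ^ 309 := by
    obtain ⟨b, hb⟩ := hBne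
    have hBH1 : CovByVAdd 𝔽 1 (B : Set 𝔽) (H : Set 𝔽) := by
      refine ⟨{b}, by simp, fun x hx => ?_⟩
      refine ⟨b, by simp, x - b, Finset.sub_mem_sub hx hb, ?_⟩
      simp
    have h2 : ((B + H).card : ℝ) ≤ 1 * 1 * κ ^ 20 * H.card := by
      refine CovByVAdd.card_le ?_
      rw [Finset.coe_add]
      exact hBH1.add_of_add .rfl hHH
    have h3 : (N : ℝ) * T.card ≤ (B + H).card := by
      exact_mod_cast (card_image_mk_mul_card_le V B hTV).trans
        (Finset.card_le_card (Finset.add_subset_add_left hTH))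
    refine le_of_mul_le_mul_right (a := (T.card : ℝ)) ?_ hTpos
    calc (N : ℝ) * T.card ≤ 1 * 1 * κ ^ 20 * H.card := h3.trans h2
      _ ≤ 1 * 1 * κ ^ 20 * (2 * κ ^ 288 * T.card) := by gcongr
      _ = 2 * κ ^ 308 * T.card := by ring
      _ ≤ κ * κ ^ 308 * T.card := by gcongr; linarith
      _ = κ ^ 309 * T.card := by ring
  obtain ⟨t, htB, htmax⟩ := Finset.exists_max_image B
    (fun t => (B.filter fun b => t - b ∈ V).card) hBne
  refine ⟨F, hYF, V, hVF, t, htB, B.filter fun b => t - b ∈ V, Finset.filter_subset _ _,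
    fun b hb => (Finset.mem_filter.1 hb).2, ?_⟩
  set p := (B.filter fun b => t - b ∈ V).card with hp
  -- Pigeonholing over N cosets would lose κ³⁰⁹. Averaging energies over Y ⊆ F loses less: as |Y| ≥
  -- κ⁴⁰⁰, the term involving N is absorbed, leaving |B| ≤ 4κ¹⁸p.
  have hsum : (∑ η ∈ Y, (dilateEnergy B η : ℝ)) ≤
      Y.card * (B.card * B.card * p) + B.card ^ 3 * N := by
    exact_mod_cast sum_dilateEnergy_le V hYF hY0 B htmax
  have hlow : (Y.card : ℝ) * (B.card : ℝ) ^ 3 ≤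
      2 * κ ^ 18 * ∑ η ∈ Y, (dilateEnergy B η : ℝ) := by
    rw [Finset.mul_sum, ← nsmul_eq_mul, ← Finset.sum_const]
    exact Finset.sum_le_sum fun η hη =>
      card_pow_three_le_mul_dilateEnergy_of_card_sub_le (hηB η hη) hBne
  set l : ℝ := (B.card : ℝ) with hl
  set y : ℝ := (Y.card : ℝ) with hy
  have hy0 : 0 < y := lt_of_lt_of_le (by positivity) hYκ
  have h5 : y * l ^ 3 ≤ 2 * κ ^ 18 * (y * (l * l * p) + l ^ 3 * κ ^ 309) :=
    hlow.trans (by gcongr; exact hsum.trans (by gcongr))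
  have h6 : 2 * (2 * κ ^ 18 * κ ^ 309) ≤ y := by
    calc 2 * (2 * κ ^ 18 * κ ^ 309) = 4 * κ ^ 327 := by ring
      _ ≤ κ * κ ^ 327 := by gcongr
      _ = κ ^ 328 := by ring
      _ ≤ κ ^ 400 := pow_le_pow_right₀ hκ1 (by norm_num)
      _ ≤ y := hYκ
  have h7 : 2 * (2 * κ ^ 18 * κ ^ 309) * l ^ 3 ≤ y * l ^ 3 := by gcongr
  have h8 : y * l ^ 2 * l ≤ y * l ^ 2 * (4 * κ ^ 18 * p) := by
    linarith [show y * l ^ 2 * l = y * l ^ 3 by ring, show 2 * κ ^ 18 * (y * (l * l * p) +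
      l ^ 3 * κ ^ 309) = 2 * κ ^ 18 * κ ^ 309 * l ^ 3 + y * l ^ 2 * (4 * κ ^ 18 * p) / 2 by ring]
  calc l ≤ 4 * κ ^ 18 * p := le_of_mul_le_mul_left h8 (by positivity)
    _ ≤ κ * κ ^ 18 * p := by gcongr
    _ = κ ^ 19 * p := by ring
    _ ≤ κ ^ 20 * p := by gcongr; norm_num

/-- A form of the theorem without logarithms, in terms of subsets of `A` for each dilate. -/
theorem exists_subfield_plane_of_forall_exists_subsets [Fintype 𝔽] {A X : Finset 𝔽}
    (hA : A.Nonempty) (hX : X.Nonempty) (h0 : (0 : 𝔽) ∉ X) {κ : ℝ} (hκ : 4 ≤ κ)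
    (hXκ : κ ^ 1504 ≤ X.card) (hXq : (X.card : ℝ) ^ 2 < Fintype.card 𝔽)
    (hqX : (Fintype.card 𝔽 : ℝ) * (2 * κ ^ 4) ^ 4 < (X.card : ℝ) ^ 4)
    (hqA : (Fintype.card 𝔽 : ℝ) * (κ ^ 85) ^ 2 ≤ (A.card : ℝ) ^ 2)
    (hAq : (A.card : ℝ) ^ 3 ≤ (Fintype.card 𝔽 : ℝ) ^ 2)
    (h : ∀ ξ ∈ X, ∃ A' ⊆ A, ∃ B' ⊆ A, (A.card : ℝ) / κ ≤ A'.card ∧ (A.card : ℝ) / κ ≤ B'.card ∧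
      ((A' - ξ • B').card : ℝ) ≤ κ ^ 3 * A.card) :
    ∃ F : Subfield 𝔽, Nat.card F ^ 3 = Fintype.card 𝔽 ∧ ∃ abar ∈ A, ∃ V : Submodule F 𝔽,
      Module.finrank F V = 2 ∧ (A.card : ℝ) ≤
        κ ^ 85 * ((((fun a : 𝔽 => a - abar) '' (A : Set 𝔽)) ∩ (V : Set 𝔽)).ncard : ℝ) := by
  have hκ0 : 0 < κ := by linarith
  have hκ1 : 1 ≤ κ := by linarith
  set q : ℝ := (Fintype.card 𝔽 : ℝ) with hq
  set n : ℝ := (A.card : ℝ) with hn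
  have hn0 : 0 < n := by rw [hn]; exact_mod_cast hA.card_pos
  obtain ⟨ξ₀, hξ₀, B₀, hB₀, B, Y, hB, h1, hY0, hXY, hnB, hBB, hηB, h3B⟩ :=
    exists_set_card_smul_sub_le hA hX h0 hκ1 h
  have hξ₀0 : ξ₀ ≠ 0 := fun h => h0 (h ▸ hξ₀)
  -- The bound |X| < q^{1/2} enters here: it makes κ a small power of q, which leaves room for the
  -- size conditions on A below.
  have hκq : κ ^ 3008 ≤ q := by
    calc κ ^ 3008 = (κ ^ 1504) ^ 2 := by ring
      _ ≤ (X.card : ℝ) ^ 2 := by gcongr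
      _ ≤ q := hXq.le
  have hq0 : 0 < q := lt_of_lt_of_le (by positivity) hκq
  have hYcard : Fintype.card 𝔽 < Y.card ^ 4 := by
    have h2 : q * (2 * κ ^ 4) ^ 4 < (Y.card : ℝ) ^ 4 * (2 * κ ^ 4) ^ 4 := by
      refine hqX.trans_le ?_
      rw [← mul_pow, mul_comm (Y.card : ℝ)]
      gcongr
    have h3 : q < (Y.card : ℝ) ^ 4 := lt_of_mul_lt_mul_right h2 (by positivity)
    rw [hq] at h3
    exact_mod_cast h3
  have hYκ : κ ^ 400 ≤ (Y.card : ℝ) := by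
    refine le_of_mul_le_mul_left (a := 2 * κ ^ 4) (le_trans ?_ (hXκ.trans hXY)) (by positivity)
    calc 2 * κ ^ 4 * κ ^ 400 ≤ κ * κ ^ 4 * κ ^ 400 := by gcongr; linarith
      _ = κ ^ 405 := by ring
      _ ≤ κ ^ 1504 := pow_le_pow_right₀ hκ1 (by norm_num)
  have hnκ : κ ^ 1000 ≤ n := by
    refine le_of_sq_le_sq ?_ hn0.le
    calc (κ ^ 1000) ^ 2 = κ ^ 2000 * 1 := by ring
      _ ≤ κ ^ 3008 * (κ ^ 85) ^ 2 := by
        refine mul_le_mul (pow_le_pow_right₀ hκ1 (by norm_num))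
          (one_le_pow₀ (one_le_pow₀ hκ1)) zero_le_one (by positivity)
      _ ≤ q * (κ ^ 85) ^ 2 := by gcongr
      _ ≤ n ^ 2 := hqA
  have hnq : κ ^ 950 * n ≤ q := by
    refine le_of_pow_le_pow_left₀ (n := 3) (by norm_num) hq0.le ?_
    calc (κ ^ 950 * n) ^ 3 = κ ^ 2850 * n ^ 3 := by ring
      _ ≤ κ ^ 3008 * q ^ 2 := by
        gcongr; norm_num
      _ ≤ q * q ^ 2 := by gcongr
      _ = q ^ 3 := by ring
  obtain ⟨F, hYF, V, hVF, t, htB, P, hPB, hPV, hBP⟩ :=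
    exists_subfield_hyperplane_of_card_smul_sub_le hκ h1 hY0 hYcard hYκ hnB hBB hηB h3B hnκ hnq
  have hnP : n ≤ κ ^ 21 * P.card := by
    calc n ≤ κ * B.card := hnB
      _ ≤ κ * (κ ^ 20 * P.card) := by gcongr
      _ = _ := by ring
  have hFcard : Fintype.card 𝔽 = Nat.card F ^ Module.finrank F 𝔽 := by
    rw [← Nat.card_eq_fintype_card]; exact Module.natCard_eq_pow_finrank
  have hVcard : Nat.card V = Nat.card F ^ Module.finrank F V := Module.natCard_eq_pow_finrank
  have hF1 : 1 < Nat.card F := Finite.one_lt_card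
  have hYleF : Y.card ≤ Nat.card F := by
    have := Set.ncard_le_ncard hYF (Set.toFinite _)
    rwa [Set.ncard_coe_finset] at this
  have hPV' : P.card ≤ Nat.card V := by
    have h2 : (P.image fun b => t - b).card = P.card :=
      Finset.card_image_of_injective _ sub_right_injective
    have h3 : ((P.image fun b => t - b : Finset 𝔽) : Set 𝔽) ⊆ V := by
      intro x hx
      obtain ⟨b, hb, rfl⟩ := Finset.mem_image.1 (Finset.mem_coe.1 hx)
      exact hPV b hb
    have := Set.ncard_le_ncard h3 (Set.toFinite _)
    rwa [Set.ncard_coe_finset, h2] at this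
  have hm4 : Module.finrank F 𝔽 < 4 := by
    rw [← Nat.pow_lt_pow_iff_right hF1, ← hFcard]
    exact hYcard.trans_le (Nat.pow_le_pow_left hYleF 4)
  have hdim : Module.finrank F V + 1 = Module.finrank F 𝔽 := by
    rw [hVcard, ← pow_succ, hFcard] at hVF
    exact Nat.pow_right_injective hF1 hVF
  -- |V| ≥ |P| ≥ κ⁻²¹|A| > q^{1/2}. As V has codimension one, this means degree greater than 2.
  have hm2 : Module.finrank F 𝔽 < Module.finrank F V * 2 := by
    rw [← Nat.pow_lt_pow_iff_right hF1, ← hFcard, pow_mul, ← hVcard]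
    have h2 : q * (κ ^ 85) ^ 2 < (Nat.card V : ℝ) ^ 2 * (κ ^ 85) ^ 2 := by
      have hPpos : (0 : ℝ) < Nat.card V := by exact_mod_cast Nat.card_pos
      calc q * (κ ^ 85) ^ 2 ≤ n ^ 2 := hqA
        _ ≤ (κ ^ 21 * Nat.card V) ^ 2 := by
          gcongr
          exact hnP.trans (by gcongr)
        _ = (Nat.card V : ℝ) ^ 2 * (κ ^ 21) ^ 2 := by ring
        _ < (Nat.card V : ℝ) ^ 2 * (κ ^ 85) ^ 2 := by
          gcongr
          · linarith
          · norm_num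
    have h3 : q < (Nat.card V : ℝ) ^ 2 := lt_of_mul_lt_mul_right h2 (by positivity)
    rw [hq] at h3
    exact_mod_cast h3
  have hm3 : Module.finrank F 𝔽 = 3 := by omega
  obtain ⟨abar, habar, rfl⟩ : ∃ a ∈ B₀, ξ₀ • a = t := Finset.mem_smul_finset.1 (hB ▸ htB)
  -- P lies in a coset of V inside ξ₀B₀, so the plane for A itself is ξ₀⁻¹V.
  refine ⟨F, by rw [hFcard, hm3], abar, hB₀ habar, V.comap (LinearMap.mulLeft F ξ₀), ?_, ?_⟩
  · have hinj : Function.Injective (LinearMap.mulLeft F ξ₀) := mul_right_injective₀ hξ₀0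
    have hsurj : Function.Surjective (LinearMap.mulLeft F ξ₀) := Finite.surjective_of_injective hinj
    have h2 := (Submodule.equivMapOfInjective (LinearMap.mulLeft F ξ₀) hinj
      (V.comap (LinearMap.mulLeft F ξ₀))).finrank_eq
    rw [Submodule.map_comap_eq_of_surjective hsurj] at h2
    rw [h2]; omega
  · have h2 : P.card ≤ (((fun a : 𝔽 => a - abar) '' (A : Set 𝔽)) ∩
        (V.comap (LinearMap.mulLeft F ξ₀) : Submodule F 𝔽)).ncard := by
      have h3 : (P.image fun b => ξ₀⁻¹ * b - abar).card = P.card :=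
        Finset.card_image_of_injective _
          ((sub_left_injective).comp (mul_right_injective₀ (inv_ne_zero hξ₀0)))
      rw [← h3, ← Set.ncard_coe_finset]
      refine Set.ncard_le_ncard ?_ (Set.toFinite _)
      intro x hx
      obtain ⟨b, hb, rfl⟩ := Finset.mem_image.1 (Finset.mem_coe.1 hx)
      obtain ⟨a, ha, rfl⟩ : ∃ a ∈ B₀, ξ₀ • a = b := Finset.mem_smul_finset.1 (hB ▸ hPB hb)
      simp only [smul_eq_mul, inv_mul_cancel_left₀ hξ₀0]
      refine ⟨⟨a, hB₀ ha, rfl⟩, ?_⟩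
      have h4 := V.neg_mem (hPV _ hb)
      rw [SetLike.mem_coe, Submodule.mem_comap, LinearMap.mulLeft_apply, mul_sub]
      rwa [neg_sub] at h4
    calc n ≤ κ ^ 21 * P.card := hnP
      _ ≤ κ ^ 85 * _ := by
        gcongr; norm_num

end Main

theorem corollary1 :
    ∃ (C₀ : ℝ) (k₀ : ℕ) (C : ℝ) (k : ℕ), 0 < C₀ ∧ 0 < C ∧
      ∀ (𝔽 : Type*) [Field 𝔽] [Fintype 𝔽] [DecidableEq 𝔽]
        (q : ℕ) (_ : Fintype.card 𝔽 = q)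
        (A X : Finset 𝔽) (_ : (0 : 𝔽) ∉ A) (_ : (0 : 𝔽) ∉ X)
        (K : ℝ) (_ : 0 < K)
        (_ : C₀ * Real.log q ^ k₀ * K ^ 1504 ≤ (X.card : ℝ))
        (_ : C₀ * Real.log q ^ k₀ * ((q : ℝ) ^ (1 / 4 : ℝ) * K ^ 4) ≤ (X.card : ℝ))
        (_ : (X.card : ℝ) < (q : ℝ) ^ (1 / 2 : ℝ))
        (_ : C₀ * Real.log q ^ k₀ * ((q : ℝ) ^ (1 / 2 : ℝ) * K ^ 85) ≤ (A.card : ℝ))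
        (_ : (A.card : ℝ) ≤ (q : ℝ) ^ (2 / 3 : ℝ))
        (_ : ∀ ξ ∈ X, (A.card : ℝ) ^ 3 / K ≤ (dilateEnergy A ξ : ℝ)),
        ∃ F : Subfield 𝔽, (Nat.card F : ℝ) = (q : ℝ) ^ (1 / 3 : ℝ) ∧
          ∃ abar ∈ A, ∃ V : Submodule F 𝔽, Module.finrank F V = 2 ∧
            (A.card : ℝ) / K ^ 85 ≤
              C * Real.log q ^ k *
                ((((fun a : 𝔽 => a - abar) '' (A : Set 𝔽)) ∩ (V : Set 𝔽)).ncard : ℝ) := by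
  -- 96 = 32 · 3: the factor 32 is that of `exists_subsets_card_sub_smul_le`, and log₂|A| + 1 ≤ 3
  -- log q because log q ≥ log 2 ≥ 2/3.
  obtain ⟨c, hc⟩ : ∃ c : ℝ, c = 96 := ⟨_, rfl⟩
  have hc0 : 0 < c := by rw [hc]; norm_num
  refine ⟨c ^ 1504, 1504, c ^ 85, 85, by positivity, by positivity, ?_⟩
  intro 𝔽 _ _ _ q hq A X _ h0 K hK hXK hqX hXq hqA hAq hE
  have hq2 : 2 ≤ q := hq ▸ Fintype.one_lt_card
  have hq0 : (0 : ℝ) < q := by positivity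
  set L := Real.log q with hL
  have hL2 : 2 / 3 ≤ L := by
    have h1 : Real.log 2 ≤ L := Real.log_le_log (by norm_num) (by exact_mod_cast hq2)
    linarith [Real.log_two_gt_d9]
  have hlam : 64 ≤ c * L := by rw [hc]; linarith
  rw [← mul_pow] at hXK hqX hqA
  have hXpos : (0 : ℝ) < X.card := lt_of_lt_of_le (by positivity) hXK
  have hApos : (0 : ℝ) < A.card := lt_of_lt_of_le (by positivity) hqA
  have hXne : X.Nonempty := Finset.card_pos.1 (by exact_mod_cast hXpos)
  have hAne : A.Nonempty := Finset.card_pos.1 (by exact_mod_cast hApos)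
  -- The trivial bound E(A, ξA) ≤ |A|³ forces K ≥ 1.
  have hK1 : 1 ≤ K := by
    obtain ⟨ξ, hξ⟩ := hXne
    have h1 : (A.card : ℝ) ^ 3 / K ≤ (A.card : ℝ) ^ 3 :=
      (hE ξ hξ).trans (by exact_mod_cast dilateEnergy_le_card_pow_three A ξ)
    rw [div_le_iff₀ hK] at h1
    exact le_of_mul_le_mul_left (by rwa [mul_one]) (show 0 < (A.card : ℝ) ^ 3 by positivity)
  have hlam1 : 1 ≤ c * L := by linarith
  have hlam0 : 0 < c * L := by linarith
  set lam := c * L with hlamdef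
  have hκ : 4 ≤ lam * K := by nlinarith
  have hlog : 32 * K * (Nat.log 2 A.card + 1 : ℕ) ≤ lam * K := by
    have hAq' : A.card ≤ q := hq ▸ Finset.card_le_univ A
    have h1 : (2 : ℝ) ^ Nat.log 2 A.card ≤ q := by
      exact_mod_cast (Nat.pow_log_le_self 2 hAne.card_pos.ne').trans hAq'
    have h2 := Real.log_le_log (by positivity) h1
    rw [Real.log_pow] at h2
    have h3 : (Nat.log 2 A.card : ℝ) * (2 / 3) ≤ L := by
      refine le_trans ?_ h2
      gcongr
      linarith [Real.log_two_gt_d9]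
    have h4 : ((Nat.log 2 A.card + 1 : ℕ) : ℝ) ≤ 3 * L := by
      push_cast; linarith
    calc 32 * K * (Nat.log 2 A.card + 1 : ℕ) ≤ 32 * K * (3 * L) := by gcongr
      _ = lam * K := by rw [hlamdef, hc]; ring
  have hr4 : ((q : ℝ) ^ (1 / 4 : ℝ)) ^ 4 = q := by
    rw [← Real.rpow_natCast, ← Real.rpow_mul hq0.le]; norm_num
  have hr2 : ((q : ℝ) ^ (1 / 2 : ℝ)) ^ 2 = q := by
    rw [← Real.rpow_natCast, ← Real.rpow_mul hq0.le]; norm_num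
  have hr3 : ((q : ℝ) ^ (2 / 3 : ℝ)) ^ 3 = (q : ℝ) ^ 2 := by
    rw [← Real.rpow_natCast, ← Real.rpow_mul hq0.le, ← Real.rpow_natCast]; norm_num
  have hr40 : 0 < (q : ℝ) ^ (1 / 4 : ℝ) := by positivity
  have hr20 : 0 < (q : ℝ) ^ (1 / 2 : ℝ) := by positivity
  set r := (q : ℝ) ^ (1 / 4 : ℝ) with hr
  set s := (q : ℝ) ^ (1 / 2 : ℝ) with hs
  have hqcast : (Fintype.card 𝔽 : ℝ) = q := by rw [hq]
  -- With κ = lam · K, the condition on |X| from K¹⁵⁰⁴ needs exactly lam¹⁵⁰⁴. The other conditions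
  -- need fewer factors lam, and the surplus is harmless since lam ≥ 1.
  obtain ⟨F, hF, abar, habar, V, hV, hAV⟩ := exists_subfield_plane_of_forall_exists_subsets hAne
    hXne h0 hκ (by rwa [mul_pow]) (by
      rw [hqcast, ← hr2]
      gcongr) (by
      rw [hqcast, ← hr4, ← mul_pow]
      gcongr
      refine lt_of_lt_of_le ?_ hqX
      calc r * (2 * (lam * K) ^ 4) = 2 * (lam ^ 4 * (r * K ^ 4)) := by ring
        _ < lam * (lam ^ 4 * (r * K ^ 4)) := by gcongr; linarith
        _ = lam ^ 5 * (r * K ^ 4) := by ring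
        _ ≤ lam ^ 1504 * (r * K ^ 4) := by gcongr; norm_num) (by
      rw [hqcast, ← hr2, ← mul_pow]
      gcongr
      refine le_trans ?_ hqA
      calc s * (lam * K) ^ 85 = lam ^ 85 * (s * K ^ 85) := by ring
        _ ≤ lam ^ 1504 * (s * K ^ 85) := by gcongr; norm_num) (by
      rw [hqcast, ← hr3]
      gcongr) (fun ξ hξ => exists_subsets_card_sub_smul_le hAne (fun h => h0 (h ▸ hξ)) hK hlog
        (hE ξ hξ))
  refine ⟨F, ?_, abar, habar, V, hV, ?_⟩
  · have h1 : ((Nat.card F : ℝ)) ^ 3 = q := by rw [← hqcast]; exact_mod_cast hF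
    rw [← h1, ← Real.rpow_natCast, ← Real.rpow_mul (Nat.cast_nonneg _)]
    norm_num
  · rw [div_le_iff₀ (by positivity)]
    refine hAV.trans (le_of_eq ?_)
    rw [hlamdef]
    ring
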